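/- **Setting.** Let $\mathcal Z,\mathcal V$ be real Hilbert spaces and $\mathcal X$ a real Banach space with $\mathcal Z\hookrightarrow\mathcal V\hookrightarrow\mathcal X$ continuously, where $\mathcal Z\hookrightarrow\mathcal V$ is dense and compact and $\|z\|_{\mathcal V}\le\|z\|_{\mathcal Z}$ for all $z\in\mathcal Z$. Let $T>0$ and $$\mathcal I(t,z)=\tfrac12\langle Az,z\rangle+\mathcal F(z)-\langle \ell(t),z\rangle ,\qquad t\in[0,T],\ z\in\mathcal Z,$$ where - $A\in\mathcal L(\mathcal Z,\mathcal Z^*)$ is self-adjoint with $\langle Az,z\rangle\ge\alpha\|z\|_{\mathcal Z}^2$ for some $\alpha>0$; - $\mathcal F\in C^2(\mathcal Z;\mathbb R)$, $\mathcal F\ge 0$, $D_z\mathcal F\in C^1(\mathcal Z,\mathcal V^*)$, and $\|D_z^2\mathcal F(z)v\|_{\mathcal V^*}\le C_{\mathcal F}(1+\|z\|_{\mathcal Z}^q)\|v\|_{\mathcal Z}$ for some $C_{\mathcal F}$ and $q\ge1$; - $\mathcal I(t,\cdot)\in C^{2,1}_{loc}$: for all $r>0$ there is $C(r)\ge0$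 with $\langle[D_z^2\mathcal I(t,z_1)-D_z^2\mathcal I(t,z_2)]v,v\rangle\le C(r)\|z_1-z_2\|_{\mathcal Z}\|v\|_{\mathcal Z}^2$ whenever $\|z_1\|_{\mathcal Z},\|z_2\|_{\mathcal Z}<r$ and $v\in\mathcal Z$; - $\mathcal I$ is $\kappa$-uniformly convex with $\kappa>0$: $\langle D_z^2\mathcal I(t,z)v,v\rangle\ge\kappa\|v\|_{\mathcal Z}^2$ for all $t\in[0,T]$, $z,v\in\mathcal Z$; - $\ell\in W^{1,\infty}([0,T];\mathcal V^*)$ with $\ell'\in BV([0,T];\mathcal V^*)$, and for some $\delta\in(0,\kappa]$ the Lipschitz constant of $\ell:[0,T]\to\mathcal V^*$ satisfies $|\ell|_{Lip}\le\kappa-\delta$. Let $\mathcal R:\mathcal V\to[0,\infty)$ be convex, lower semicontinuous and positively homogeneous of degree one, with $\underline\rho\|v\|_{\mathcal X}\le\mathcal R(v)\le\overline\rho\|v\|_{\mathcal V}$ for some constants $\underline\rho,\overline\rho>0$, and let $z_0\in\mathcal Z$ satisfy $0\in\partial\mathcal R(0)+D_z\mathcal I(0,z_0)$. A *differential solution*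 is a function $z\in W^{1,1}(0,T;\mathcal Z)$ with $z(0)=z_0$ and $0\in\partial\mathcal R(z'(t))+D_z\mathcal I(t,z(t))$ for almost all $t\in[0,T]$. For $\tau>0$, *iterates* of the local incremental minimization scheme are sequences with $t_0=0$, initial state $z_0$ and, for $k\ge1$, $$z_k\in\operatorname{argmin}\{\mathcal I(t_{k-1},z)+\mathcal R(z-z_{k-1}) : z\in\mathcal Z,\ \|z-z_{k-1}\|_{\mathcal V}\le\tau\},\qquad t_k=\min\{t_{k-1}+\tau-\|z_k-z_{k-1}\|_{\mathcal V},\,T\}.$$ Let $N(\tau)$ be the first index with $t_{N(\tau)}=T$, put $s_k=k\tau$ and $S_\tau=s_{N(\tau)}$, and let $\hat z_\tau,\hat t_\tau$ be the continuous piecewise affine functions on $[0,S_\tau]$ with $\hat z_\tau(s_k)=z_k$, $\hat t_\tau(s_k)=t_k$. If $\hat t_\tau$ is a bijection from $[0,S_\tau]$ onto $[0,T]$, with inverse $s_\tau$, put $z_\tau(t)=\hat z_\tau(s_\tau(t))$ for $t\in[0,T]$. **Theorem.** Under these assumptions there is a unique differential solution $z$. For every $\tau>0$ iterates exist, and for every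 choice of iterates $T$ is reached after finitely many steps and $\hat t_\tau:[0,S_\tau]\to[0,T]$ is a strictly increasing bijection, so that $z_\tau$ is defined. There is a constant $K>0$, independent of $\tau$ and of the choice of the iterates, such that $$\|z_\tau(t)-z(t)\|_{\mathcal Z}\le K\tau\qquad\text{for all } t\in[0,T] \text{ and all } \tau>0 .$$ In particular $z_\tau\to z$ in $\mathcal Z$, uniformly on $[0,T]$, as $\tau\searrow0$. For fixed spaces and embeddings, $K$ depends only on $\alpha,\kappa,\ell,z_0,T,\mathcal F$ and $\|A\|_{\mathcal L(\mathcal Z,\mathcal Z^*)}$; in particular it does not depend on $\mathcal R$. -/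

import Mathlib

open Set Filter Topology MeasureTheory
open scoped ENNReal

noncomputable section

namespace RIS

section Spaces

variable {Z V X : Type*}
  [NormedAddCommGroup Z] [InnerProductSpace ℝ Z]
  [NormedAddCommGroup V] [InnerProductSpace ℝ V]
  [NormedAddCommGroup X] [NormedSpace ℝ X]

/-- The compact and dense embedding of `Z` into `V`, with embedding constant one. -/
structure IsCompactDenseEmbedding (ι : Z →L[ℝ] V) : Prop where
  injective : Function.Injective ι
  denseRange : DenseRange ι
  compact : IsCompactOperator ι
  norm_le : ∀ z, ‖ι z‖ ≤ ‖z‖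

/-- `g` is the derivative of `u ∈ W^{1,p}(0,T;E)`, where `u` is the continuous representative:
`g ∈ L^p(0,T;E)` and `u` is a primitive of `g` on `[0,T]`. -/
structure IsSobolevDeriv {E : Type*} [NormedAddCommGroup E] [NormedSpace ℝ E]
    (p : ℝ≥0∞) (T : ℝ) (u g : ℝ → E) : Prop where
  memLp : MemLp g p (volume.restrict (Icc 0 T))
  eq_primitive : ∀ t ∈ Icc 0 T, u t = u 0 + ∫ s in (0 : ℝ)..t, g s

/-- `ℓ ∈ W^{1,∞}([0,T];V*)` with `ℓ' ∈ BV([0,T];V*)`: some representative `m` of the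
derivative has finite variation on `[0,T]`. -/
def IsLoadBV (T : ℝ) (ℓ : ℝ → StrongDual ℝ V) : Prop :=
  ∃ m : ℝ → StrongDual ℝ V, IsSobolevDeriv ∞ T ℓ m ∧ BoundedVariationOn m (Icc 0 T)

/-- The standing assumptions on the quadratic part: `A` is self-adjoint and coercive with
constant `α`. -/
structure IsCoerciveSymm (α : ℝ) (A : Z →L[ℝ] StrongDual ℝ Z) : Prop where
  symm : ∀ x y, A x y = A y x
  coercive : ∀ z, α * ‖z‖ ^ 2 ≤ A z z

/-- The standing assumptions on the non-quadratic part: `F ∈ C²(Z;ℝ)` is nonnegative, its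
derivative is (the restriction to `Z` of) a map `G ∈ C¹(Z;V*)`, and the derivative of `G` has
polynomial growth. -/
structure IsLowerOrder (ι : Z →L[ℝ] V) (F : Z → ℝ) : Prop where
  contDiff : ContDiff ℝ 2 F
  nonneg : ∀ z, 0 ≤ F z
  lower_order : ∃ G : Z → StrongDual ℝ V, ContDiff ℝ 1 G ∧
    (∀ z, fderiv ℝ F z = (G z).comp ι) ∧
    ∃ C q : ℝ, 1 ≤ q ∧ ∀ z v, ‖fderiv ℝ G z v‖ ≤ C * (1 + ‖z‖ ^ q) * ‖v‖

/-- The standing assumptions on the dissipation potential `R : V → [0,∞)`; here `j` is the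
embedding of `V` into `X`. -/
structure IsDissipation (j : V →L[ℝ] X) (R : V → ℝ) : Prop where
  nonneg : ∀ v, 0 ≤ R v
  lsc : LowerSemicontinuous R
  convex : ConvexOn ℝ univ R
  homogeneous : ∀ c : ℝ, 0 < c → ∀ v, R (c • v) = c * R v
  bounded : ∃ ρ₁ ρ₂ : ℝ, 0 < ρ₁ ∧ 0 < ρ₂ ∧ ∀ v, ρ₁ * ‖j v‖ ≤ R v ∧ R v ≤ ρ₂ * ‖v‖

/-- The semilinear energy `I(t,z) = ½⟨Az,z⟩ + F(z) - ⟨ℓ(t),z⟩`. -/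
def energy (ι : Z →L[ℝ] V) (A : Z →L[ℝ] StrongDual ℝ Z) (F : Z → ℝ)
    (ℓ : ℝ → StrongDual ℝ V) (t : ℝ) (z : Z) : ℝ :=
  1 / 2 * A z z + F z - ℓ t (ι z)

/-- `I(t,·) ∈ C^{2,1}_loc`: the second derivative is Lipschitz on balls, as a quadratic form. -/
def IsC21loc (I : Z → ℝ) : Prop :=
  ∀ r : ℝ, 0 < r → ∃ C : ℝ, 0 ≤ C ∧ ∀ z₁ ∈ Metric.ball (0 : Z) r, ∀ z₂ ∈ Metric.ball (0 : Z) r,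
    ∀ v : Z, (fderiv ℝ (fderiv ℝ I) z₁ - fderiv ℝ (fderiv ℝ I) z₂) v v
      ≤ C * ‖z₁ - z₂‖ * ‖v‖ ^ 2

/-- `κ`-uniform convexity of `I(t,·)`, through the second derivative. -/
def IsUniformlyConvex (κ : ℝ) (I : Z → ℝ) : Prop :=
  ∀ z v : Z, κ * ‖v‖ ^ 2 ≤ fderiv ℝ (fderiv ℝ I) z v v

/-- The convex subdifferential `∂R(v) ⊆ V*`. -/
def subdifferential (R : V → ℝ) (v : V) : Set (StrongDual ℝ V) :=
  {ξ | ∀ w, R v + ξ (w - v) ≤ R w}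

/-- The inclusion `0 ∈ ∂R(v) + DI(z)` in `Z*`, for `v, z ∈ Z` and an energy `I` on `Z`;
functionals on `V` are restricted to `Z`. -/
def Inclusion (ι : Z →L[ℝ] V) (R : V → ℝ) (I : Z → ℝ) (v z : Z) : Prop :=
  ∃ ξ ∈ subdifferential R (ι v), ξ.comp ι + fderiv ℝ I z = 0

/-- Differential solutions: `z ∈ W^{1,1}(0,T;Z)`, `z(0) = z₀` and
`0 ∈ ∂R(z'(t)) + D_zI(t,z(t))` for almost all `t ∈ [0,T]`. -/
def IsDifferentialSolution (ι : Z →L[ℝ] V) (R : V → ℝ) (I : ℝ → Z → ℝ) (T : ℝ) (z₀ : Z)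
    (z : ℝ → Z) : Prop :=
  ∃ z' : ℝ → Z, IsSobolevDeriv 1 T z z' ∧ z 0 = z₀ ∧
    ∀ᵐ t ∂(volume.restrict (Icc 0 T)), Inclusion ι R (I t) (z' t) (z t)

/-- `(z_k, t_k)` are iterates of the local incremental minimization scheme with step size `τ`
(the iteration is simply continued once the final time has been reached). -/
structure IsLocalMinScheme (ι : Z →L[ℝ] V) (R : V → ℝ) (I : ℝ → Z → ℝ) (T : ℝ) (z₀ : Z)
    (τ : ℝ) (z : ℕ → Z) (t : ℕ → ℝ) : Prop where
  z_zero : z 0 = z₀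
  t_zero : t 0 = 0
  mem_argmin : ∀ k, ‖ι (z (k + 1) - z k)‖ ≤ τ ∧
    ∀ w : Z, ‖ι (w - z k)‖ ≤ τ →
      I (t k) (z (k + 1)) + R (ι (z (k + 1) - z k)) ≤ I (t k) w + R (ι (w - z k))
  t_update : ∀ k, t (k + 1) = min (t k + τ - ‖ι (z (k + 1) - z k)‖) T

/-- The number `N(τ)` of steps to reach the final time. -/
def finalIndex (T : ℝ) (t : ℕ → ℝ) : ℕ := sInf {k | t k = T}

/-- The piecewise affine interpolant of the values `x_k` at the artificial times `s_k = kτ`: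
for `s ∈ [s_k, s_{k+1})` it is `x_k + (s - s_k)/(s_{k+1} - s_k) (x_{k+1} - x_k)`. -/
def affineInterpolant {E : Type*} [NormedAddCommGroup E] [NormedSpace ℝ E]
    (τ : ℝ) (x : ℕ → E) (s : ℝ) : E :=
  x ⌊s / τ⌋₊ + ((s - ⌊s / τ⌋₊ * τ) / τ) • (x (⌊s / τ⌋₊ + 1) - x ⌊s / τ⌋₊)

/-- The artificial time interval `[0, S_τ]`, with `S_τ = s_{N(τ)}`. -/
def artificialInterval (T τ : ℝ) (t : ℕ → ℝ) : Set ℝ := Icc 0 (finalIndex T t * τ)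

/-- The retransformed discrete solution `z_τ(t) = ẑ_τ(s_τ(t))`, where
`s_τ : [0,T] → [0,S_τ]` is the inverse of the interpolated time `t̂_τ`. -/
def retransformed (T τ : ℝ) (z : ℕ → Z) (t : ℕ → ℝ) (r : ℝ) : Z :=
  affineInterpolant τ z
    (Function.invFunOn (affineInterpolant τ t) (artificialInterval T τ t) r)

end Spaces

end RIS

end

/-! Everything rests on one stability estimate, `ApproxData.norm_diff_le`. Call `σ = L - D(y)` the
driving force of a curve `y`. A solution is a curve whose force stays below `R` and whose power
satisfies `R(y') ≤ σ(y')`. For two solutions and `w = y₁ - y₂`, testing each force with the velocity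
of the other curve gives `(σ₂ - σ₁)(w') ≤ 0`, that is `(D(y₁) - D(y₂))(w') ≤ 0`. Since the curves
have speed at most one, the left side is half the derivative of `H(y₁)(w, w)` up to a multiple of
`‖w‖²`. This quadratic form dominates `κ‖w‖²`, so Grönwall's argument applies.

The estimate survives defects. A force defect `q` of size `η²` and a total power defect of size `η²`
change `‖w‖²` by `O(η²)`. A force defect `p` of size only `η` is allowed if its variation is also
`O(η)`: it is integrated by parts in time and costs `η` times the maximum of `‖w‖`. Hence curves of
levels `η₁`, `η₂` differ by `O(η₁ + η₂)`. The estimate is used three times: two exact solutions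
(levels zero) give uniqueness; interpolants with vanishing step sizes form a Cauchy sequence whose
limit is a solution (`exists_isStrongSolution`); an interpolant against the solution gives the error
bound.

For the scheme, `κ`-convexity and the Lipschitz bound `κ - δ` on the load make every increment
strictly shorter than `τ` (`IsLocalMinScheme.step`). So the constraint is never active, time
advances by at least `δτ/κ` until `T` is reached, and `z_{k+1}` satisfies the implicit Euler
conditions at time `t_k`. The shifted sequence `k ↦ z_{k+1}` is therefore an incremental solution on
the grid `t_k`.

Its affine interpolant has level `O(τ)` because the power defects `(σ_{k+1} - σ_k)(y_{k+1} - y_k)`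
sum to `O(τ²)`, one order better than bounding them one by one. This is `second_difference_le`
together with `IsIncremental.sum_increments_le`: comparison with the previous velocity makes the
Hessian terms telescope, and the bounded variation of the load derivative controls the rest. -/

namespace RIS

/-- `D` is the derivative of a uniformly convex energy with Hessian `H`, with uniform bounds on
the ball of radius `r`. -/
structure IsEnergyDeriv {Z : Type*} [NormedAddCommGroup Z] [InnerProductSpace ℝ Z]
    (r Λ C κ : ℝ) (D : Z → StrongDual ℝ Z) (H : Z → Z →L[ℝ] StrongDual ℝ Z) : Prop where
  hasFDerivAt : ∀ x, HasFDerivAt D (H x) x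
  symm : ∀ x u v, H x u v = H x v u
  coercive : ∀ x v, κ * ‖v‖ ^ 2 ≤ H x v v
  bound : ∀ x, ‖x‖ ≤ r → ‖H x‖ ≤ Λ
  lipschitz : ∀ x y, ‖x‖ ≤ r → ‖y‖ ≤ r → ‖H x - H y‖ ≤ C * ‖x - y‖

/-- Sublinear functionals with linear growth. -/
structure IsSublinear {E : Type*} [NormedAddCommGroup E] [NormedSpace ℝ E]
    (ρ : ℝ) (R : E → ℝ) : Prop where
  nonneg : ∀ v, 0 ≤ R v
  homogeneous : ∀ c : ℝ, 0 < c → ∀ v, R (c • v) = c * R v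
  subadditive : ∀ u v, R (u + v) ≤ R u + R v
  growth : ∀ v, R v ≤ ρ * ‖v‖

section Dual

variable {E F : Type*} [NormedAddCommGroup E] [NormedSpace ℝ E]

theorem dual_apply_le (f : StrongDual ℝ E) (x : E) : f x ≤ ‖f‖ * ‖x‖ :=
  (le_abs_self _).trans (f.le_opNorm x)

theorem bilin_apply_le (f : E →L[ℝ] StrongDual ℝ E) (x y : E) : f x y ≤ ‖f‖ * ‖x‖ * ‖y‖ :=
  (le_abs_self _).trans (f.le_opNorm₂ x y)

end Dual

/-! ### Monotonicity and Grönwall arguments from right increments -/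

section Dini

/-- One-sided increments are the common language for interpolants, which have kinks at the grid
points, and for exact solutions, which are differentiable only almost everywhere. -/
theorem le_of_right_increments {f : ℝ → ℝ} {a b : ℝ} (hab : a ≤ b)
    (hf : ContinuousOn f (Icc a b))
    (h : ∀ s ∈ Ico a b, ∀ ε > 0, ∀ᶠ t in 𝓝[>] s, f t - f s ≤ ε * (t - s)) : f b ≤ f a := by
  refine image_le_of_liminf_slope_right_le_deriv_boundary (B := fun _ => f a) (B' := fun _ => 0)
    hf le_rfl continuousOn_const (fun x _ => hasDerivWithinAt_const _ _ _) ?_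
    (right_mem_Icc.2 hab)
  intro x hx r hr
  refine Eventually.frequently ?_
  filter_upwards [h x hx (r / 2) (by linarith), self_mem_nhdsWithin] with t ht htx
  have h0 : 0 < t - x := sub_pos.2 htx
  rw [slope_def_field, div_lt_iff₀ h0]
  nlinarith

theorem eventually_right_mem_Icc {a b s : ℝ} (hs : s ∈ Ico a b) :
    ∀ᶠ t in 𝓝[>] s, s < t ∧ t ∈ Icc a b := by
  filter_upwards [Ioo_mem_nhdsGT hs.2] with t ht
  exact ⟨ht.1, hs.1.trans ht.1.le, ht.2.le⟩

/-- The function `exp(-ct) f(t) - G(t)` has nonpositive right increments to first order. The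
exponential is at most one, so it does not enlarge the increments of `G`, provided these are
nonnegative. -/
theorem gronwall_of_right_increments {f G : ℝ → ℝ} {c T : ℝ} (hc : 0 ≤ c)
    (hf : ContinuousOn f (Icc 0 T)) (hG : ContinuousOn G (Icc 0 T))
    (hf0 : ∀ t ∈ Icc 0 T, 0 ≤ f t)
    (h : ∀ s ∈ Ico 0 T, ∀ ε > 0, ∀ᶠ t in 𝓝[>] s,
      G s ≤ G t ∧ f t - f s ≤ c * (t - s) * f s + (G t - G s) + ε * (t - s)) :
    ∀ t ∈ Icc 0 T, Real.exp (-(c * t)) * f t ≤ f 0 + (G t - G 0) := by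
  intro b hb
  have key := le_of_right_increments (f := fun t => Real.exp (-(c * t)) * f t - G t) hb.1
    (((by fun_prop : Continuous fun t : ℝ => Real.exp (-(c * t))).continuousOn.mul
      (hf.mono (Icc_subset_Icc_right hb.2))).sub (hG.mono (Icc_subset_Icc_right hb.2))) ?_
  · simp only [mul_zero, neg_zero, Real.exp_zero, one_mul] at key
    linarith
  intro s hs ε hε
  have hs' : s ∈ Ico 0 T := ⟨hs.1, hs.2.trans_le hb.2⟩
  filter_upwards [h s hs' ε hε, eventually_right_mem_Icc hs'] with t ⟨h1, h2⟩ ⟨h3, h4⟩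
  have hst : 0 < t - s := sub_pos.2 h3
  have e1 : Real.exp (-(c * t)) ≤ 1 := Real.exp_le_one_iff.2 (by nlinarith [h4.1])
  have e0 := Real.exp_pos (-(c * t))
  have e2 : Real.exp (-(c * s)) ≥ Real.exp (-(c * t)) * (1 + c * (t - s)) := by
    have : Real.exp (-(c * s)) = Real.exp (-(c * t)) * Real.exp (c * (t - s)) := by
      rw [← Real.exp_add]; ring_nf
    rw [this]
    exact mul_le_mul_of_nonneg_left (by linarith [Real.add_one_le_exp (c * (t - s))]) e0.le
  have e3 := mul_le_mul_of_nonneg_right e2 (hf0 s ⟨hs'.1, hs'.2.le⟩)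
  have e4 := mul_le_mul_of_nonneg_left h2 e0.le
  have e5 : Real.exp (-(c * t)) * ((G t - G s) + ε * (t - s)) ≤ (G t - G s) + ε * (t - s) :=
    mul_le_of_le_one_left (add_nonneg (sub_nonneg.2 h1) (mul_nonneg hε.le hst.le)) e1
  nlinarith

theorem norm_sub_le_of_right_increments {E : Type*} [NormedAddCommGroup E]
    {y : ℝ → E} {T : ℝ} (hy : ContinuousOn y (Icc 0 T))
    (h : ∀ s ∈ Ico 0 T, ∀ᶠ t in 𝓝[>] s, ‖y t - y s‖ ≤ t - s) {a b : ℝ} (ha : 0 ≤ a)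
    (hab : a ≤ b) (hb : b ≤ T) : ‖y b - y a‖ ≤ b - a := by
  have key := le_of_right_increments (f := fun t => ‖y t - y a‖ - t) hab
    (((hy.mono (Icc_subset_Icc ha hb)).sub continuousOn_const).norm.sub continuousOn_id) ?_
  · simp only [sub_self, norm_zero] at key; linarith
  intro s hs ε hε
  filter_upwards [h s ⟨ha.trans hs.1, hs.2.trans_le hb⟩, self_mem_nhdsWithin] with t ht hst
  have h0 : 0 < t - s := sub_pos.2 hst
  have := norm_sub_le_norm_sub_add_norm_sub (y t) (y s) (y a)
  nlinarith

end Dini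

/-! ### Taylor expansion and monotonicity of the energy derivative -/

section Energy

variable {Z : Type*} [NormedAddCommGroup Z] [InnerProductSpace ℝ Z]
  {r Λ C κ : ℝ} {D : Z → StrongDual ℝ Z} {H : Z → Z →L[ℝ] StrongDual ℝ Z}

theorem IsEnergyDeriv.lipschitz_deriv (hD : IsEnergyDeriv r Λ C κ D H) {x y : Z}
    (hx : ‖x‖ ≤ r) (hy : ‖y‖ ≤ r) : ‖D x - D y‖ ≤ Λ * ‖x - y‖ :=
  (convex_closedBall (0 : Z) r).norm_image_sub_le_of_norm_hasFDerivWithin_le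
    (fun z _ => (hD.hasFDerivAt z).hasFDerivWithinAt)
    (fun z hz => hD.bound z (mem_closedBall_zero_iff.1 hz))
    (mem_closedBall_zero_iff.2 hy) (mem_closedBall_zero_iff.2 hx)

/-- The mean value inequality on the segment, where the Hessian deviates from `H y` by at most `C‖x
- y‖`. -/
theorem IsEnergyDeriv.taylor (hD : IsEnergyDeriv r Λ C κ D H) (hC : 0 ≤ C) {x y : Z}
    (hx : ‖x‖ ≤ r) (hy : ‖y‖ ≤ r) : ‖D x - D y - H y (x - y)‖ ≤ C * ‖x - y‖ ^ 2 := by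
  have key := (convex_segment y x).norm_image_sub_le_of_norm_hasFDerivWithin_le' (f := D)
    (f' := H) (φ := H y) (C := C * ‖x - y‖) (x := y) (y := x)
    (fun z _ => (hD.hasFDerivAt z).hasFDerivWithinAt) ?_ (left_mem_segment ℝ y x)
    (right_mem_segment ℝ y x)
  · linarith
  intro z hz
  have hzr : ‖z‖ ≤ r := mem_closedBall_zero_iff.1
    ((convex_closedBall (0 : Z) r).segment_subset (mem_closedBall_zero_iff.2 hy)
      (mem_closedBall_zero_iff.2 hx) hz)
  refine (hD.lipschitz z y hzr hy).trans (mul_le_mul_of_nonneg_left ?_ hC)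
  obtain ⟨a, b, ha, hb, hab, rfl⟩ := hz
  have : a • y + b • x - y = b • (x - y) := by
    rw [← sub_eq_zero]; have : a = 1 - b := by linarith
    subst this; module
  rw [this, norm_smul, Real.norm_of_nonneg hb]
  exact mul_le_of_le_one_left (norm_nonneg _) (by linarith)

theorem IsEnergyDeriv.monotone (hD : IsEnergyDeriv r Λ C κ D H) (x y : Z) :
    κ * ‖x - y‖ ^ 2 ≤ (D x - D y) (x - y) := by
  set w := x - y with hw
  have hder : ∀ s : ℝ, HasDerivAt (fun s : ℝ => D (y + s • w) w - κ * s * ‖w‖ ^ 2)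
      (H (y + s • w) w w - κ * ‖w‖ ^ 2) s := by
    intro s
    have h1 : HasDerivAt (fun s : ℝ => y + s • w) w s := by
      simpa using ((hasDerivAt_id s).smul_const w).const_add y
    have h2 := ((hD.hasFDerivAt (y + s • w)).comp_hasDerivAt s h1)
    have h3 := h2.clm_apply (hasDerivAt_const s w)
    have h4 := h3.sub (((hasDerivAt_id s).const_mul κ).mul_const (‖w‖ ^ 2))
    refine (h4.congr_deriv ?_).congr_of_eventuallyEq (Eventually.of_forall fun s => ?_) <;> simp
  have hmono : Monotone (fun s : ℝ => D (y + s • w) w - κ * s * ‖w‖ ^ 2) := by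
    apply monotone_of_deriv_nonneg (fun s => (hder s).differentiableAt)
    intro s
    rw [(hder s).deriv]
    linarith [hD.coercive (y + s • w) w]
  have := hmono (zero_le_one' ℝ)
  simp only [zero_smul, add_zero, one_smul, mul_zero, zero_mul, sub_zero, mul_one] at this
  rw [_root_.sub_apply]
  have e : y + w = x := by rw [hw]; abel
  rw [e] at this
  linarith

end Energy

/-! ### Approximate solutions and the stability estimate -/

section Approx

variable {Z : Type*} [NormedAddCommGroup Z] [InnerProductSpace ℝ Z]
  {r Λ C κ : ℝ} {D : Z → StrongDual ℝ Z} {H : Z → Z →L[ℝ] StrongDual ℝ Z}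

/-- `y` is a solution of the rate-independent system up to defects of size `η`: the driving
force `σ` is stable and differs from `L - D(y)` by `p + q`, where `p` is of size `η` with
variation controlled by `P`, and the power balance holds up to the increments of `B`. -/
structure ApproxData (T r : ℝ) (z₀ : Z) (L : ℝ → StrongDual ℝ Z) (D : Z → StrongDual ℝ Z)
    (R : Z → ℝ) (η : ℝ) (y : ℝ → Z) (σ p q : ℝ → StrongDual ℝ Z) (P B : ℝ → ℝ) : Prop where
  init : y 0 = z₀
  cont : ContinuousOn y (Icc 0 T)
  cont_p : ContinuousOn p (Icc 0 T)
  cont_P : ContinuousOn P (Icc 0 T)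
  cont_B : ContinuousOn B (Icc 0 T)
  ball : ∀ t ∈ Icc 0 T, ‖y t‖ ≤ r
  stable : ∀ t ∈ Icc 0 T, ∀ w, σ t w ≤ R w
  force : ∀ t ∈ Icc 0 T, σ t = L t - D (y t) + p t + q t
  p_le : ∀ t ∈ Icc 0 T, ‖p t‖ ≤ η
  q_le : ∀ t ∈ Icc 0 T, ‖q t‖ ≤ η ^ 2
  P_zero : P 0 = 0
  P_le : ∀ t ∈ Icc 0 T, P t ≤ η
  B_zero : B 0 = 0
  B_le : ∀ t ∈ Icc 0 T, B t ≤ η ^ 2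
  right_lip : ∀ s ∈ Ico 0 T, ∀ᶠ t in 𝓝[>] s, ‖y t - y s‖ ≤ t - s
  right_p : ∀ s ∈ Ico 0 T, ∀ᶠ t in 𝓝[>] s, ‖p t - p s‖ ≤ P t - P s
  right_B : ∀ s ∈ Ico 0 T, ∀ᶠ t in 𝓝[>] s, B s ≤ B t
  right_power : ∀ s ∈ Ico 0 T, ∀ ε > 0, ∀ᶠ t in 𝓝[>] s,
    R (y t - y s) ≤ σ s (y t - y s) + (B t - B s) + ε * (t - s)

/-- Approximate solutions of level `η`. -/
def IsApproxSolution (T r : ℝ) (z₀ : Z) (L : ℝ → StrongDual ℝ Z) (D : Z → StrongDual ℝ Z)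
    (R : Z → ℝ) (η : ℝ) (y : ℝ → Z) : Prop :=
  ∃ (σ p q : ℝ → StrongDual ℝ Z) (P B : ℝ → ℝ), ApproxData T r z₀ L D R η y σ p q P B

/-- A discrete chain rule for `H(x)(w, w)`. Twice `C‖w‖²` times the increment bound `2h` comes from
replacing `H(x)w` by `D x - D u`, another `2Ch‖w‖²` from moving the base point of `H`; the last
bracket is `o(h)`. -/
theorem quadratic_increment_le (hD : IsEnergyDeriv r Λ C κ D H) (hC : 0 ≤ C)
    {x x' u u' : Z} {h : ℝ} (hx : ‖x‖ ≤ r) (hx' : ‖x'‖ ≤ r) (hu : ‖u‖ ≤ r)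
    (h1 : ‖x' - x‖ ≤ h) (h2 : ‖u' - u‖ ≤ h) :
    H x' (x' - u') (x' - u') - H x (x - u) (x - u) ≤
      2 * (D x - D u) ((x' - u') - (x - u)) + 6 * C * h * ‖x - u‖ ^ 2
        + (8 * C * h ^ 3 + 4 * Λ * h ^ 2) := by
  set w := x - u
  set w' := x' - u'
  set d := w' - w with hd
  have hh : 0 ≤ h := (norm_nonneg _).trans h1
  have hdn : ‖d‖ ≤ 2 * h := by
    have : d = (x' - x) - (u' - u) := by simp only [hd, w, w']; abel
    rw [this]; linarith [norm_sub_le (x' - x) (u' - u)]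
  have hΛ : 0 ≤ Λ := (norm_nonneg (H x)).trans (hD.bound x hx)
  have e1 : (H x' - H x) w' w' ≤ C * h * ‖w'‖ ^ 2 := by
    refine (bilin_apply_le _ _ _).trans ?_
    rw [mul_assoc, ← sq]
    refine mul_le_mul_of_nonneg_right ((hD.lipschitz _ _ hx' hx).trans ?_) (sq_nonneg _)
    exact mul_le_mul_of_nonneg_left h1 hC
  have e2 : H x d d ≤ 4 * Λ * h ^ 2 := by
    refine (bilin_apply_le _ _ _).trans ?_
    rw [mul_assoc, ← sq]
    have : ‖d‖ ^ 2 ≤ 4 * h ^ 2 := by nlinarith [norm_nonneg d]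
    nlinarith [mul_le_mul (hD.bound x hx) this (sq_nonneg _) hΛ]
  have e3 : H x w d ≤ (D x - D u) d + C * ‖w‖ ^ 2 * (2 * h) := by
    have t := hD.taylor hC hu hx
    have t1 : H x w d - (D x - D u) d = (D u - D x - H x (u - x)) d := by
      have : u - x = -w := by simp [w]
      rw [this]; simp only [map_neg, _root_.sub_apply, _root_.neg_apply]; ring
    have t2 := (dual_apply_le (D u - D x - H x (u - x)) d).trans
      (mul_le_mul t hdn (norm_nonneg _) (by positivity))
    rw [norm_sub_rev u x] at t2
    linarith
  have e4 : H x' w' w' - H x w w = (H x' - H x) w' w' + 2 * H x w d + H x d d := by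
    have : w' = w + d := by simp [hd]
    have s := hD.symm x d w
    rw [this]
    simp only [map_add, _root_.sub_apply, _root_.add_apply] at s ⊢
    linarith
  have e5 : ‖w'‖ ^ 2 ≤ 2 * ‖w‖ ^ 2 + 8 * h ^ 2 := by
    have : ‖w'‖ ≤ ‖w‖ + 2 * h := by
      have h3 : w' = w + d := by simp [hd]
      rw [h3]; exact (norm_add_le _ _).trans (by linarith)
    nlinarith [norm_nonneg w', norm_nonneg w, sq_nonneg (‖w‖ - 2 * h)]
  have e6 : C * h * ‖w'‖ ^ 2 ≤ C * h * (2 * ‖w‖ ^ 2 + 8 * h ^ 2) :=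
    mul_le_mul_of_nonneg_left e5 (by positivity)
  nlinarith

theorem IsEnergyDeriv.continuousOn_comp (hD : IsEnergyDeriv r Λ C κ D H) {y : ℝ → Z} {S : Set ℝ}
    (hy : ContinuousOn y S) : ContinuousOn (fun t => D (y t)) S :=
  (continuous_iff_continuousAt.2 fun x => (hD.hasFDerivAt x).continuousAt).comp_continuousOn hy

/-- Closes the stability estimate, where the maximal distance `m` also occurs linearly on the right:
if `m` exceeded the claimed multiple of `η`, the square would dominate. -/
theorem le_of_sq_le {a m η T : ℝ} (ha : 0 ≤ a) (hη : 0 ≤ η) (hT : 0 ≤ T)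
    (h : m ^ 2 ≤ a * (4 * η * m + (4 * T + 2) * η ^ 2)) : m ≤ (4 * a + 4 * T + 3) * η := by
  by_contra! hc
  have hm : 0 < m := lt_of_le_of_lt (by positivity) hc
  have h1 : (4 * a + 4 * T + 3) * η * m ≤ m ^ 2 := by nlinarith
  have h2 : (4 * T + 3) * η * m ≤ a * ((4 * T + 2) * η ^ 2) := by nlinarith
  rcases hη.eq_or_lt with rfl | hη'
  · nlinarith
  have h3 : (4 * T + 3) * m ≤ a * ((4 * T + 2) * η) := by
    have : η * ((4 * T + 3) * m) ≤ η * (a * ((4 * T + 2) * η)) := by nlinarith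
    exact le_of_mul_le_mul_left this hη'
  have h4 : 4 * a * η ≤ m := by nlinarith [mul_nonneg hT hη]
  nlinarith [mul_nonneg (mul_nonneg ha hT) hη, mul_nonneg ha hη]

/-- Approximate solutions of levels `η₁`, `η₂` differ by at most a multiple of `η₁ + η₂`. -/
theorem ApproxData.norm_diff_le (hD : IsEnergyDeriv r Λ C κ D H) (hC : 0 ≤ C) (hκ : 0 < κ)
    {T : ℝ} (hT : 0 < T) {z₀ : Z} {L : ℝ → StrongDual ℝ Z} {R : Z → ℝ} {η₁ η₂ : ℝ}
    {y₁ y₂ : ℝ → Z} {σ₁ p₁ q₁ σ₂ p₂ q₂ : ℝ → StrongDual ℝ Z} {P₁ B₁ P₂ B₂ : ℝ → ℝ}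
    (h₁ : ApproxData T r z₀ L D R η₁ y₁ σ₁ p₁ q₁ P₁ B₁)
    (h₂ : ApproxData T r z₀ L D R η₂ y₂ σ₂ p₂ q₂ P₂ B₂) :
    ∀ t ∈ Icc 0 T, ‖y₁ t - y₂ t‖ ≤
      (4 * (Real.exp (6 * C / κ * T) / κ) + 4 * T + 3) * (η₁ + η₂) := by
  have h0T : (0 : ℝ) ∈ Icc 0 T := left_mem_Icc.2 hT.le
  have hη₁ : 0 ≤ η₁ := (norm_nonneg _).trans (h₁.p_le 0 h0T)
  have hη₂ : 0 ≤ η₂ := (norm_nonneg _).trans (h₂.p_le 0 h0T)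
  have hcw : ContinuousOn (fun t => y₁ t - y₂ t) (Icc 0 T) := h₁.cont.sub h₂.cont
  -- The maximum `m` of `‖w‖` is fixed beforehand, because after the integration by parts the
  -- variation of `p` is paired with `w` itself.
  obtain ⟨t₀, ht₀, hmax⟩ := isCompact_Icc.exists_isMaxOn ⟨0, h0T⟩ hcw.norm
  set m := ‖y₁ t₀ - y₂ t₀‖ with hm
  have hwm : ∀ t ∈ Icc 0 T, ‖y₁ t - y₂ t‖ ≤ m := fun t ht => hmax ht
  have hm0 : 0 ≤ m := norm_nonneg _
  set η := η₁ + η₂ with hη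
  have hη0 : 0 ≤ η := add_nonneg hη₁ hη₂
  -- The term with `p₁ - p₂` is the boundary term of the integration by parts; the constant `2ηm`
  -- compensates its sign, so that `f` still dominates `κ‖w‖²`.
  set f : ℝ → ℝ := fun t => H (y₁ t) (y₁ t - y₂ t) (y₁ t - y₂ t)
    - 2 * (p₁ t - p₂ t) (y₁ t - y₂ t) + 2 * η * m with hf
  -- Accumulated defects: variation of `p` against `m`, size of `q` against `‖w'‖ ≤ 2`, and power
  -- defects, all doubled by the quadratic form.
  set G : ℝ → ℝ := fun t => 2 * m * (P₁ t + P₂ t) + 4 * (η₁ ^ 2 + η₂ ^ 2) * t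
    + 2 * (B₁ t + B₂ t) with hG
  have hfκ : ∀ t ∈ Icc 0 T, κ * ‖y₁ t - y₂ t‖ ^ 2 ≤ f t := by
    intro t ht
    have a1 := hD.coercive (y₁ t) (y₁ t - y₂ t)
    have a2 := dual_apply_le (p₁ t - p₂ t) (y₁ t - y₂ t)
    have a3 : ‖p₁ t - p₂ t‖ ≤ η :=
      (norm_sub_le _ _).trans (add_le_add (h₁.p_le t ht) (h₂.p_le t ht))
    have a4 := mul_le_mul a3 (hwm t ht) (norm_nonneg _) hη0
    simp only [hf]
    linarith
  have hHc : ContinuousOn (fun t => H (y₁ t)) (Icc 0 T) := by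
    have : LipschitzOnWith ⟨C, hC⟩ H (Metric.closedBall 0 r) := by
      apply LipschitzOnWith.of_dist_le_mul
      intro x hx y hy
      rw [dist_eq_norm, dist_eq_norm]
      exact hD.lipschitz x y (mem_closedBall_zero_iff.1 hx) (mem_closedBall_zero_iff.1 hy)
    exact this.continuousOn.comp h₁.cont fun t ht => mem_closedBall_zero_iff.2 (h₁.ball t ht)
  have hfc : ContinuousOn f (Icc 0 T) :=
    (((hHc.clm_apply hcw).clm_apply hcw).sub
      (continuousOn_const.mul ((h₁.cont_p.sub h₂.cont_p).clm_apply hcw))).add continuousOn_const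
  have hGc : ContinuousOn G (Icc 0 T) :=
    ((continuousOn_const.mul (h₁.cont_P.add h₂.cont_P)).add
      (continuousOn_const.mul continuousOn_id)).add
      (continuousOn_const.mul (h₁.cont_B.add h₂.cont_B))
  have main := gronwall_of_right_increments (c := 6 * C / κ) (by positivity) hfc hGc
    (fun t ht => (by positivity : 0 ≤ κ * ‖y₁ t - y₂ t‖ ^ 2).trans (hfκ t ht)) ?_ t₀ ht₀
  · have hG0 : G 0 = 0 := by simp [hG, h₁.P_zero, h₂.P_zero, h₁.B_zero, h₂.B_zero]
    have hf0 : f 0 = 2 * η * m := by simp [hf, h₁.init, h₂.init]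
    have hGt : G t₀ ≤ 2 * m * η + (4 * T + 2) * η ^ 2 := by
      have b1 : P₁ t₀ + P₂ t₀ ≤ η := add_le_add (h₁.P_le _ ht₀) (h₂.P_le _ ht₀)
      have b2 : η₁ ^ 2 + η₂ ^ 2 ≤ η ^ 2 := by nlinarith
      have b3 : B₁ t₀ + B₂ t₀ ≤ η ^ 2 := (add_le_add (h₁.B_le _ ht₀) (h₂.B_le _ ht₀)).trans b2
      have b4 := mul_le_mul b2 ht₀.2 ht₀.1 (sq_nonneg η)
      have b5 := mul_le_mul_of_nonneg_left b1 hm0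
      simp only [hG]
      linarith
    have hexp : f t₀ ≤ Real.exp (6 * C / κ * T) * (4 * η * m + (4 * T + 2) * η ^ 2) := by
      have c1 : f t₀ = Real.exp (6 * C / κ * t₀) * (Real.exp (-(6 * C / κ * t₀)) * f t₀) := by
        rw [← mul_assoc, ← Real.exp_add]; simp
      rw [c1]
      refine mul_le_mul (Real.exp_le_exp.2 (mul_le_mul_of_nonneg_left ht₀.2 (by positivity)))
        (by linarith) (mul_nonneg (Real.exp_pos _).le
          ((by positivity : 0 ≤ κ * ‖y₁ t₀ - y₂ t₀‖ ^ 2).trans (hfκ _ ht₀))) (Real.exp_pos _).le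
    have hsq : m ^ 2 ≤ Real.exp (6 * C / κ * T) / κ * (4 * η * m + (4 * T + 2) * η ^ 2) := by
      rw [div_mul_eq_mul_div, le_div_iff₀ hκ]
      linarith [hfκ t₀ ht₀]
    intro t ht
    exact (hwm t ht).trans (le_of_sq_le (by positivity) hη0 hT.le hsq)
  intro s hs ε hε
  have hsI : s ∈ Icc 0 T := ⟨hs.1, hs.2.le⟩
  have hsmall : ∀ᶠ t in 𝓝[>] s, 8 * C * (t - s) ^ 2 + 4 * Λ * (t - s) ≤ ε / 2 := by
    have : Tendsto (fun t => 8 * C * (t - s) ^ 2 + 4 * Λ * (t - s)) (𝓝 s)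
        (𝓝 (8 * C * (s - s) ^ 2 + 4 * Λ * (s - s))) := by
      apply Continuous.tendsto (f := fun t => 8 * C * (t - s) ^ 2 + 4 * Λ * (t - s))
      fun_prop
    have h3 := this.mono_left (nhdsWithin_le_nhds (s := Ioi s))
    exact h3.eventually (eventually_le_nhds (by simpa using hε))
  filter_upwards [h₁.right_lip s hs, h₂.right_lip s hs, h₁.right_p s hs, h₂.right_p s hs,
    h₁.right_B s hs, h₂.right_B s hs, h₁.right_power s hs (ε / 8) (by positivity),
    h₂.right_power s hs (ε / 8) (by positivity), eventually_right_mem_Icc hs, hsmall]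
    with t l1 l2 pp1 pp2 b1 b2 e1 e2 ht hsm
  have htI := ht.2
  have hst : 0 < t - s := sub_pos.2 ht.1
  have hP1 := (norm_nonneg _).trans pp1
  have hP2 := (norm_nonneg _).trans pp2
  refine ⟨?_, ?_⟩
  · simp only [hG]
    have : 0 ≤ (η₁ ^ 2 + η₂ ^ 2) * (t - s) := by positivity
    nlinarith
  have k1 := quadratic_increment_le hD hC (h₁.ball s hsI) (h₁.ball t htI) (h₂.ball s hsI)
    (h := t - s) l1 l2
  set w := y₁ s - y₂ s
  set w' := y₁ t - y₂ t
  -- Monotonicity of the subdifferential up to defects: stability of each force is tested with the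
  -- increment of the other curve and compared with the power balance.
  have k2 : (σ₂ s - σ₁ s) (w' - w) ≤ (B₁ t - B₁ s) + (B₂ t - B₂ s) + ε / 4 * (t - s) := by
    have g1 := h₂.stable s hsI (y₁ t - y₁ s)
    have g2 := h₁.stable s hsI (y₂ t - y₂ s)
    have : w' - w = (y₁ t - y₁ s) - (y₂ t - y₂ s) := by simp only [w, w']; abel
    rw [this, map_sub, _root_.sub_apply, _root_.sub_apply]
    linarith
  have k3 : σ₂ s - σ₁ s = (D (y₁ s) - D (y₂ s)) - (p₁ s - p₂ s) - (q₁ s - q₂ s) := by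
    rw [h₁.force s hsI, h₂.force s hsI]; abel
  have hdn : ‖w' - w‖ ≤ 2 * (t - s) := by
    have : w' - w = (y₁ t - y₁ s) - (y₂ t - y₂ s) := by simp only [w, w']; abel
    rw [this]; linarith [norm_sub_le (y₁ t - y₁ s) (y₂ t - y₂ s)]
  have k4 : (q₁ s - q₂ s) (w' - w) ≤ (η₁ ^ 2 + η₂ ^ 2) * (2 * (t - s)) := by
    refine (dual_apply_le _ _).trans (mul_le_mul ?_ hdn (norm_nonneg _) (by positivity))
    exact (norm_sub_le _ _).trans (add_le_add (h₁.q_le s hsI) (h₂.q_le s hsI))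
  have k5 : -((p₁ t - p₂ t) - (p₁ s - p₂ s)) w' ≤ ((P₁ t - P₁ s) + (P₂ t - P₂ s)) * m := by
    rw [← _root_.neg_apply]
    refine (dual_apply_le _ _).trans (mul_le_mul ?_ (hwm t htI) (norm_nonneg _) (by linarith))
    rw [norm_neg]
    have : (p₁ t - p₂ t) - (p₁ s - p₂ s) = (p₁ t - p₁ s) - (p₂ t - p₂ s) := by abel
    rw [this]
    exact (norm_sub_le _ _).trans (add_le_add pp1 pp2)
  -- Summation by parts: the increment moves from `w` to `p₁ - p₂`.
  have k6 : (p₁ s - p₂ s) (w' - w) = (p₁ t - p₂ t) w' - (p₁ s - p₂ s) w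
      - ((p₁ t - p₂ t) - (p₁ s - p₂ s)) w' := by
    rw [map_sub, _root_.sub_apply (p₁ t - p₂ t)]; ring
  have k7 : (D (y₁ s) - D (y₂ s)) (w' - w) = (σ₂ s - σ₁ s) (w' - w)
      + (p₁ s - p₂ s) (w' - w) + (q₁ s - q₂ s) (w' - w) := by
    rw [k3]; simp only [_root_.sub_apply]; ring
  have k8 : 8 * C * (t - s) ^ 3 + 4 * Λ * (t - s) ^ 2 ≤ ε / 2 * (t - s) := by
    have := mul_le_mul_of_nonneg_right hsm hst.le
    nlinarith
  have k9 : 6 * C * (t - s) * ‖w‖ ^ 2 ≤ 6 * C / κ * (t - s) * f s := by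
    have := mul_le_mul_of_nonneg_left (hfκ s hsI)
      (by positivity : 0 ≤ 6 * C / κ * (t - s))
    refine le_trans (le_of_eq ?_) this
    field_simp
    rfl
  have k10 : f t - f s = (H (y₁ t) w' w' - H (y₁ s) w w)
      - 2 * ((p₁ t - p₂ t) w' - (p₁ s - p₂ s) w) := by simp only [hf, w, w']; ring
  have k11 : G t - G s = 2 * m * ((P₁ t - P₁ s) + (P₂ t - P₂ s))
      + 4 * (η₁ ^ 2 + η₂ ^ 2) * (t - s) + 2 * ((B₁ t - B₁ s) + (B₂ t - B₂ s)) := by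
    simp only [hG]; ring
  rw [k10, k11]
  linarith

end Approx

/-! ### Sublinear functionals and Hahn–Banach -/

section Sublinear

variable {E : Type*} [NormedAddCommGroup E] [NormedSpace ℝ E] {ρ : ℝ} {R : E → ℝ}

theorem IsSublinear.map_zero (hR : IsSublinear ρ R) : R 0 = 0 := by
  have := hR.homogeneous 2 two_pos 0
  rw [smul_zero] at this
  linarith

theorem IsSublinear.abs_sub_le (hR : IsSublinear ρ R) (u v : E) : |R u - R v| ≤ ρ * ‖u - v‖ := by
  have h1 := hR.subadditive (u - v) v
  have h2 := hR.subadditive (v - u) u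
  rw [sub_add_cancel] at h1 h2
  have h3 := hR.growth (u - v)
  have h4 := hR.growth (v - u)
  rw [norm_sub_rev] at h4
  rw [abs_le]
  constructor <;> linarith

theorem IsSublinear.continuous (hR : IsSublinear ρ R) : Continuous R := by
  refine continuous_iff_continuousAt.2 fun x => ?_
  rw [ContinuousAt, tendsto_iff_norm_sub_tendsto_zero]
  have h : Tendsto (fun y => ρ * ‖y - x‖) (𝓝 x) (𝓝 0) := by
    have : Continuous fun y => ρ * ‖y - x‖ := by fun_prop
    simpa using this.tendsto x
  exact squeeze_zero (fun _ => norm_nonneg _) (fun y => hR.abs_sub_le y x) h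

theorem IsSublinear.norm_le (hR : IsSublinear ρ R) (g : E →ₗ[ℝ] ℝ) (hg : ∀ x, g x ≤ R x) (x : E) :
    ‖g x‖ ≤ ρ * ‖x‖ := by
  have h1 := (hg x).trans (hR.growth x)
  have h2 := (hg (-x)).trans (hR.growth (-x))
  rw [map_neg, norm_neg] at h2
  rw [Real.norm_eq_abs, abs_le]
  constructor <;> linarith

/-- A sublinear functional is the maximum of the linear functionals below it. -/
theorem IsSublinear.exists_support (hR : IsSublinear ρ R) (u : E) :
    ∃ ξ : StrongDual ℝ E, (∀ w, ξ w ≤ R w) ∧ ξ u = R u := by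
  rcases eq_or_ne u 0 with rfl | hu
  · exact ⟨0, fun w => by simpa using hR.nonneg w, by simp [hR.map_zero]⟩
  let l : E →ₗ.[ℝ] ℝ := LinearPMap.mkSpanSingleton u (R u) hu
  have hle : ∀ x : l.domain, l x ≤ R x := by
    rintro ⟨x, hx⟩
    obtain ⟨c, rfl⟩ := Submodule.mem_span_singleton.1 hx
    change LinearPMap.mkSpanSingleton' _ _ _ _ ≤ _
    rw [LinearPMap.mkSpanSingleton'_apply, smul_eq_mul]
    change c * R u ≤ R (c • u)
    rcases lt_trichotomy c 0 with hc | rfl | hc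
    · exact (mul_nonpos_of_nonpos_of_nonneg hc.le (hR.nonneg u)).trans (hR.nonneg _)
    · simp [hR.map_zero]
    · rw [hR.homogeneous c hc]
  obtain ⟨g, hg1, hg2⟩ := exists_extension_of_le_sublinear l R hR.homogeneous hR.subadditive hle
  refine ⟨g.mkContinuous ρ (hR.norm_le g hg2), hg2, ?_⟩
  have := hg1 ⟨u, Submodule.mem_span_singleton_self u⟩
  rwa [LinearPMap.mkSpanSingleton_apply] at this

end Sublinear

/-! ### Lipschitz curves in a Hilbert space are primitives -/

section Primitive

variable {Z : Type*} [NormedAddCommGroup Z] [InnerProductSpace ℝ Z] [CompleteSpace Z]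

/-- After a shift of variables the integral equals the mean of `z` over a short interval starting at
`t` minus that over one starting at `0`. -/
theorem tendsto_integral_diff_quotient {z : ℝ → Z} (hz : Continuous z) (t : ℝ) :
    Tendsto (fun n : ℕ => ∫ s in (0 : ℝ)..t, ((n : ℝ) + 1) • (z (s + 1 / ((n : ℝ) + 1)) - z s))
      atTop (𝓝 (z t - z 0)) := by
  have hint : ∀ a b : ℝ, IntervalIntegrable z volume a b := fun a b => hz.intervalIntegrable a b
  have hder : ∀ a : ℝ, Tendsto (fun n : ℕ => ((n : ℝ) + 1) • ∫ s in a..(a + 1 / ((n : ℝ) + 1)), z s)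
      atTop (𝓝 (z a)) := by
    intro a
    have h1 := hasDerivAt_iff_tendsto_slope_zero.1
      (intervalIntegral.integral_hasDerivAt_right (hint a a)
        (hz.stronglyMeasurableAtFilter _ _) hz.continuousAt)
    have h2 : Tendsto (fun n : ℕ => 1 / ((n : ℝ) + 1)) atTop (𝓝[≠] 0) :=
      tendsto_nhdsWithin_iff.2 ⟨tendsto_one_div_add_atTop_nhds_zero_nat,
        Eventually.of_forall fun n => ne_of_gt (by positivity)⟩
    refine (h1.comp h2).congr fun n => ?_
    simp
  refine ((hder t).sub (hder 0)).congr fun n => ?_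
  rw [intervalIntegral.integral_smul, ← smul_sub]
  congr 1
  have hs := hz.comp (continuous_add_const (1 / ((n : ℝ) + 1)))
  rw [intervalIntegral.integral_sub (f := fun x => z (x + 1 / ((n : ℝ) + 1)))
    (hs.intervalIntegrable _ _) (hint _ _), intervalIntegral.integral_comp_add_right z]
  have e := intervalIntegral.integral_add_adjacent_intervals (hint 0 (0 + 1 / ((n : ℝ) + 1)))
    (hint (0 + 1 / ((n : ℝ) + 1)) (t + 1 / ((n : ℝ) + 1)))
  have e' := intervalIntegral.integral_add_adjacent_intervals (hint 0 t)
    (hint t (t + 1 / ((n : ℝ) + 1)))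
  rw [eq_sub_of_add_eq' e, eq_sub_of_add_eq' e']
  abel

/-- Lipschitz functions with values in a Hilbert space are primitives. -/
theorem exists_sobolevDeriv_of_lipschitz {T : ℝ} {z : ℝ → Z}
    (hz : LipschitzWith 1 z) : ∃ g : ℝ → Z, IsSobolevDeriv 1 T z g := by
  set μ := volume.restrict (Icc (0 : ℝ) T) with hμ
  set g : ℕ → ℝ → Z := fun n s => ((n : ℝ) + 1) • (z (s + 1 / ((n : ℝ) + 1)) - z s) with hg
  have hgc : ∀ n, Continuous (g n) := fun n => by
    have := hz.continuous
    simp only [hg]; fun_prop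
  have hgb : ∀ n s, ‖g n s‖ ≤ 1 := by
    intro n s
    have h1 := hz.dist_le_mul (s + 1 / ((n : ℝ) + 1)) s
    rw [dist_eq_norm, dist_eq_norm] at h1
    have h2 : (0 : ℝ) < (n : ℝ) + 1 := by positivity
    simp only [hg, norm_smul, Real.norm_of_nonneg h2.le]
    simp only [NNReal.coe_one, one_mul, add_sub_cancel_left, Real.norm_of_nonneg
      (by positivity : (0 : ℝ) ≤ 1 / ((n : ℝ) + 1))] at h1
    calc ((n : ℝ) + 1) * ‖z (s + 1 / ((n : ℝ) + 1)) - z s‖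
        ≤ ((n : ℝ) + 1) * (1 / ((n : ℝ) + 1)) := mul_le_mul_of_nonneg_left h1 h2.le
      _ = 1 := by field_simp
  have hgL : ∀ n, MemLp (g n) 2 μ := fun n =>
    MemLp.of_bound (hgc n).aestronglyMeasurable 1 (Eventually.of_forall (hgb n))
  set M : ℝ := μ.real univ ^ (ENNReal.toReal 2)⁻¹ * 1
  have hGb : ∀ n, ‖(hgL n).toLp (g n)‖ ≤ M := by
    intro n
    refine Lp.norm_le_of_ae_bound zero_le_one ?_
    filter_upwards [(hgL n).coeFn_toLp] with s hs
    rw [hs]; exact hgb n s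
  -- The difference quotients are bounded in the Hilbert space `L²(0,T;Z)`. Banach–Alaoglu, along an
  -- ultrafilter finer than `atTop`, gives a weak limit `G`, the candidate derivative.
  let φ : ℕ → WeakDual ℝ (Lp Z 2 μ) := fun n =>
    StrongDual.toWeakDual (InnerProductSpace.toDual ℝ (Lp Z 2 μ) ((hgL n).toLp (g n)))
  have hφ : ((Ultrafilter.map φ (hyperfilter ℕ) : Ultrafilter _) : Filter _) ≤
      𝓟 (WeakDual.toStrongDual ⁻¹' Metric.closedBall (0 : StrongDual ℝ (Lp Z 2 μ)) M) := by
    rw [le_principal_iff]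
    refine Filter.Eventually.of_forall (p := fun n => φ n ∈ _) fun n => ?_
    have h1 := (LinearIsometryEquiv.norm_map (InnerProductSpace.toDual ℝ (Lp Z 2 μ))
      ((hgL n).toLp (g n))).trans_le (hGb n)
    rw [← dist_zero_right] at h1
    exact h1
  obtain ⟨x, -, hx⟩ := (WeakDual.isCompact_closedBall (𝕜 := ℝ)
    (0 : StrongDual ℝ (Lp Z 2 μ)) M).ultrafilter_le_nhds _ hφ
  have hx' : Tendsto φ (hyperfilter ℕ) (𝓝 x) := hx
  set G : Lp Z 2 μ := (InnerProductSpace.toDual ℝ (Lp Z 2 μ)).symm (WeakDual.toStrongDual x)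
  have hG2 : MemLp (G : ℝ → Z) 2 μ := Lp.memLp G
  refine ⟨G, hG2.mono_exponent (by norm_num), fun t ht => ?_⟩
  have hint : ∀ f : ℝ → Z, ∫ s in Ioc 0 t, f s ∂μ = ∫ s in (0 : ℝ)..t, f s := by
    intro f
    rw [intervalIntegral.integral_of_le ht.1, hμ, Measure.restrict_restrict measurableSet_Ioc,
      inter_eq_left.2 (Ioc_subset_Icc_self.trans (Icc_subset_Icc_right ht.2))]
  -- Testing the weak limit with the indicator of `(0,t]` times `c` identifies the integral of `G`.
  have key : ∀ c : Z, inner ℝ c (∫ s in (0 : ℝ)..t, G s) = inner ℝ c (z t - z 0) := by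
    intro c
    set w : Lp Z 2 μ := indicatorConstLp 2 (measurableSet_Ioc (a := (0 : ℝ)) (b := t))
      (measure_ne_top μ _) c
    have e1 : ∀ f : Lp Z 2 μ, inner ℝ w f = inner ℝ c (∫ s in (0 : ℝ)..t, f s) := by
      intro f
      rw [← hint]
      exact L2.inner_indicatorConstLp_eq_inner_setIntegral ℝ measurableSet_Ioc
        (measure_ne_top μ _) c f
    have t1 : Tendsto (fun n => φ n w) (hyperfilter ℕ) (𝓝 (x w)) :=
      ((WeakDual.eval_continuous w).tendsto x).comp hx'
    have t2 : ∀ n, φ n w = inner ℝ c (∫ s in (0 : ℝ)..t, g n s) := by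
      intro n
      change inner ℝ ((hgL n).toLp (g n)) w = _
      rw [real_inner_comm, e1, ← hint, ← hint]
      congr 1
      exact setIntegral_congr_ae measurableSet_Ioc
        ((hgL n).coeFn_toLp.mono fun s hs _ => hs)
    have t3 : x w = inner ℝ c (∫ s in (0 : ℝ)..t, G s) := by
      rw [← e1, real_inner_comm]
      change WeakDual.toStrongDual x w = _
      rw [← InnerProductSpace.toDual_apply_apply (𝕜 := ℝ), LinearIsometryEquiv.apply_symm_apply]
    have t4 : Tendsto (fun n => φ n w) (hyperfilter ℕ) (𝓝 (inner ℝ c (z t - z 0))) := by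
      simp only [t2]
      refine Tendsto.mono_left ?_ (Nat.hyperfilter_le_atTop)
      exact tendsto_const_nhds.inner (tendsto_integral_diff_quotient hz.continuous t)
    rw [← t3]
    exact tendsto_nhds_unique t1 t4
  rw [ext_inner_left ℝ key]
  abel

end Primitive

/-! ### Integral representation and almost everywhere differentiability -/

section Sobolev

variable {E : Type*} [NormedAddCommGroup E] [NormedSpace ℝ E]

theorem IsSobolevDeriv.intervalIntegrable {T : ℝ} {z g : ℝ → E}
    (h : IsSobolevDeriv 1 T z g) {s t : ℝ} (hs : s ∈ Icc 0 T) (ht : t ∈ Icc 0 T) :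
    IntervalIntegrable g volume s t := by
  have h1 : IntegrableOn g (Icc 0 T) := memLp_one_iff_integrable.1 h.memLp
  exact (h1.mono_set (uIcc_subset_Icc hs ht)).intervalIntegrable

theorem IsSobolevDeriv.sub_eq {T : ℝ} (hT : 0 ≤ T) {z g : ℝ → E}
    (h : IsSobolevDeriv 1 T z g) {s t : ℝ} (hs : s ∈ Icc 0 T) (ht : t ∈ Icc 0 T) :
    z t - z s = ∫ r in s..t, g r := by
  have h0 : (0 : ℝ) ∈ Icc 0 T := left_mem_Icc.2 hT
  rw [h.eq_primitive t ht, h.eq_primitive s hs, add_sub_add_left_eq_sub,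
    intervalIntegral.integral_interval_sub_left (h.intervalIntegrable h0 ht)
      (h.intervalIntegrable h0 hs)]

theorem IsSobolevDeriv.continuousOn {T : ℝ} (hT : 0 ≤ T) {z g : ℝ → E}
    (h : IsSobolevDeriv 1 T z g) : ContinuousOn z (Icc 0 T) := by
  have h1 : IntegrableOn g (uIcc 0 T) := by
    rw [uIcc_of_le hT]; exact memLp_one_iff_integrable.1 h.memLp
  have h2 := intervalIntegral.continuousOn_primitive_interval h1
  rw [uIcc_of_le hT] at h2
  exact (continuousOn_const.add h2).congr h.eq_primitive

theorem IsSobolevDeriv.ae_hasDerivAt [CompleteSpace E] {T : ℝ} (hT : 0 ≤ T) {z g : ℝ → E}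
    (h : IsSobolevDeriv 1 T z g) :
    ∀ᵐ t ∂(volume.restrict (Icc 0 T)), t ∈ Ioo 0 T ∧ HasDerivAt z (g t) t := by
  have h0 : (0 : ℝ) ∈ Icc 0 T := left_mem_Icc.2 hT
  have h1 := (h.intervalIntegrable h0 (right_mem_Icc.2 hT)).ae_hasDerivAt_integral
  rw [uIcc_of_le hT] at h1
  have ha : ∀ᵐ x : ℝ, x ≠ 0 := by simp [ae_iff, measure_singleton]
  have hb : ∀ᵐ x : ℝ, x ≠ T := by simp [ae_iff, measure_singleton]
  rw [ae_restrict_iff' measurableSet_Icc]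
  filter_upwards [h1, ha, hb] with t h2 h3 h4 h5
  have h6 : t ∈ Ioo 0 T := ⟨lt_of_le_of_ne h5.1 h3.symm, lt_of_le_of_ne h5.2 h4⟩
  refine ⟨h6, ((h2 h5 0 h0).const_add (z 0)).congr_of_eventuallyEq ?_⟩
  filter_upwards [Ioo_mem_nhds h6.1 h6.2] with s hs
  exact h.eq_primitive s ⟨hs.1.le, hs.2.le⟩

end Sobolev

/-! ### Exact solutions as approximate solutions of level zero, and as their limits -/

section StrongSolution

variable {Z : Type*} [NormedAddCommGroup Z] [InnerProductSpace ℝ Z] [CompleteSpace Z]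
  {r Λ C κ ρ T : ℝ} {D : Z → StrongDual ℝ Z} {H : Z → Z →L[ℝ] StrongDual ℝ Z}
  {L : ℝ → StrongDual ℝ Z} {R : Z → ℝ} {z₀ : Z}

/-- Solutions of the rate-independent system in terms of stability and power balance. -/
def IsStrongSolution (T : ℝ) (z₀ : Z) (L : ℝ → StrongDual ℝ Z) (D : Z → StrongDual ℝ Z)
    (R : Z → ℝ) (z : ℝ → Z) : Prop :=
  ∃ z' : ℝ → Z, IsSobolevDeriv 1 T z z' ∧ z 0 = z₀ ∧
    ∀ᵐ t ∂(volume.restrict (Icc 0 T)),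
      (∀ w, (L t - D (z t)) w ≤ R w) ∧ R (z' t) ≤ (L t - D (z t)) (z' t)

theorem continuousOn_of_lipschitz_bound {E : Type*} [NormedAddCommGroup E] {f : ℝ → E} {S : Set ℝ}
    {c : ℝ} (h : ∀ s ∈ S, ∀ t ∈ S, ‖f s - f t‖ ≤ c * |s - t|) : ContinuousOn f S := by
  intro x hx
  rw [ContinuousWithinAt, tendsto_iff_norm_sub_tendsto_zero]
  have h1 : Tendsto (fun y => c * |y - x|) (𝓝[S] x) (𝓝 0) := by
    have : Continuous fun y => c * |y - x| := by fun_prop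
    have h2 := this.tendsto x
    simp only [sub_self, abs_zero, mul_zero] at h2
    exact h2.mono_left nhdsWithin_le_nhds
  refine squeeze_zero' (Eventually.of_forall fun _ => norm_nonneg _) ?_ h1
  filter_upwards [self_mem_nhdsWithin] with y hy
  exact h y hy x hx

omit [CompleteSpace Z] in
theorem norm_force_sub_le (hD : IsEnergyDeriv r Λ C κ D H)
    (hL : ∀ s ∈ Icc 0 T, ∀ t ∈ Icc 0 T, ‖L s - L t‖ ≤ κ * |s - t|) {z : ℝ → Z}
    (hball : ∀ t ∈ Icc 0 T, ‖z t‖ ≤ r)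
    {s t : ℝ} (hs : s ∈ Icc 0 T) (ht : t ∈ Icc 0 T) (hst : s ≤ t) (hz : ‖z t - z s‖ ≤ t - s) :
    ‖(L t - D (z t)) - (L s - D (z s))‖ ≤ (κ + Λ) * (t - s) := by
  have h1 := hL t ht s hs
  rw [abs_of_nonneg (sub_nonneg.2 hst)] at h1
  have hΛ : 0 ≤ Λ := (norm_nonneg (H (z t))).trans (hD.bound _ (hball t ht))
  have h2 := (hD.lipschitz_deriv (hball t ht) (hball s hs)).trans
    (mul_le_mul_of_nonneg_left hz hΛ)
  have : (L t - D (z t)) - (L s - D (z s)) = (L t - L s) - (D (z t) - D (z s)) := by abel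
  rw [this]
  linarith [norm_sub_le (L t - L s) (D (z t) - D (z s))]

/-- All defects vanish. What has to be found is the everywhere information: stability at every time,
speed at most one, and the power balance for small increments to the right of every time. -/
theorem IsStrongSolution.isApproxSolution (hD : IsEnergyDeriv r Λ C κ D H) (hκ : 0 < κ)
    (hR : IsSublinear ρ R) (hT : 0 < T)
    (hL : ∀ s ∈ Icc 0 T, ∀ t ∈ Icc 0 T, ‖L s - L t‖ ≤ κ * |s - t|) (hr : ‖z₀‖ + T ≤ r)
    {z : ℝ → Z} (hz : IsStrongSolution T z₀ L D R z) : IsApproxSolution T r z₀ L D R 0 z := by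
  obtain ⟨z', hz', hz0, hae⟩ := hz
  have hcont := hz'.continuousOn hT.le
  set σ : ℝ → StrongDual ℝ Z := fun t => L t - D (z t) with hσ
  have hσc : ContinuousOn σ (Icc 0 T) :=
    (continuousOn_of_lipschitz_bound hL).sub (IsEnergyDeriv.continuousOn_comp hD hcont)
  -- Stability passes from almost every time to every time by continuity of the force.
  have hstable : ∀ t ∈ Icc 0 T, ∀ w, σ t w ≤ R w := by
    intro t ht w
    have h1 : (fun t => max (σ t w - R w) 0) =ᵐ[volume.restrict (Icc 0 T)] fun _ => 0 := by
      filter_upwards [hae] with s hs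
      exact max_eq_right (sub_nonpos.2 (hs.1 w))
    have h2 := Measure.eqOn_Icc_of_ae_eq volume hT.ne h1
      (ContinuousOn.sup ((hσc.clm_apply continuousOn_const).sub continuousOn_const)
        continuousOn_const)
      continuousOn_const ht
    exact sub_nonpos.1 (max_eq_right_iff.1 h2)
  -- With `v = z'(t)` and `s < t`, one has `σ(s)v ≤ R(v) ≤ σ(t)v`, so the increment of `D(z)v` is at
  -- most that of `L v`. Dividing by `t - s` gives `κ‖v‖² ≤ H(z(t))(v, v) ≤ κ‖v‖`.
  have hbound : ∀ᵐ t ∂(volume.restrict (Icc 0 T)), ‖z' t‖ ≤ 1 := by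
    filter_upwards [hae, hz'.ae_hasDerivAt hT.le] with t ⟨_, ht1⟩ ⟨ht2, ht3⟩
    set v := z' t
    have hd : HasDerivAt (fun s => D (z s) v) (H (z t) v v) t := by
      have := ((hD.hasFDerivAt (z t)).comp_hasDerivAt t ht3).clm_apply (hasDerivAt_const t v)
      simpa using this
    have hslope := (hasDerivAt_iff_tendsto_slope.1 hd).mono_left
      (nhdsWithin_mono t (fun s (hs : s < t) => ne_of_lt hs) : 𝓝[<] t ≤ 𝓝[≠] t)
    have hle : H (z t) v v ≤ κ * ‖v‖ := by
      refine le_of_tendsto hslope ?_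
      filter_upwards [Ioo_mem_nhdsLT ht2.1] with s hs
      have hsT : s ∈ Icc 0 T := ⟨hs.1.le, hs.2.le.trans ht2.2.le⟩
      have h1 : σ s v ≤ σ t v := (hstable s hsT v).trans ht1
      have h2 := hL t ⟨ht2.1.le, ht2.2.le⟩ s hsT
      have h3 := (dual_apply_le (L t - L s) v).trans (mul_le_mul_of_nonneg_right h2 (norm_nonneg v))
      have hst : 0 < t - s := sub_pos.2 hs.2
      rw [abs_of_pos hst] at h3
      rw [slope_comm, slope_def_field, div_le_iff₀ hst]
      simp only [hσ, _root_.sub_apply] at h1 h3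
      linarith
    have h4 := (hD.coercive (z t) v).trans hle
    by_contra! hc
    nlinarith [mul_pos hκ (by linarith : 0 < ‖v‖)]
  have hlip : ∀ s ∈ Icc 0 T, ∀ t ∈ Icc 0 T, s ≤ t → ‖z t - z s‖ ≤ t - s := by
    intro s hs t ht hst
    rw [hz'.sub_eq hT.le hs ht]
    have := intervalIntegral.norm_integral_le_of_norm_le_const_ae (f := z') (a := s) (b := t)
      (C := 1) ?_
    · rwa [one_mul, abs_of_nonneg (sub_nonneg.2 hst)] at this
    rw [ae_restrict_iff' measurableSet_Icc] at hbound
    filter_upwards [hbound] with x hx hxst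
    rw [uIoc_of_le hst] at hxst
    exact hx ⟨hs.1.trans hxst.1.le, hxst.2.trans ht.2⟩
  have hball : ∀ t ∈ Icc 0 T, ‖z t‖ ≤ r := by
    intro t ht
    have h1 := hlip 0 (left_mem_Icc.2 hT.le) t ht ht.1
    have h2 := norm_le_norm_add_norm_sub' (z t) (z 0)
    rw [hz0] at h1 h2
    linarith [ht.2]
  refine ⟨σ, 0, 0, 0, 0, hz0, hcont, continuousOn_const, continuousOn_const, continuousOn_const,
    hball, hstable, fun t _ => by simp [hσ], by simp, by simp, rfl, by simp, rfl, by simp,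
    fun s hs => ?_, by simp, by simp, fun s hs ε hε => ?_⟩
  · filter_upwards [eventually_right_mem_Icc hs] with t ht
    exact hlip s ⟨hs.1, hs.2.le⟩ t ht.2 ht.1.le
  · have hsI : s ∈ Icc 0 T := ⟨hs.1, hs.2.le⟩
    have hΛ : 0 ≤ Λ := (norm_nonneg (H (z s))).trans (hD.bound _ (hball s hsI))
    have hsmall : ∀ᶠ t in 𝓝[>] s, (κ + Λ) * (t - s) ≤ ε := by
      have : Continuous fun t => (κ + Λ) * (t - s) := by fun_prop
      have h0 := (this.tendsto s).mono_left (nhdsWithin_le_nhds (s := Ioi s))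
      rw [sub_self, mul_zero] at h0
      exact h0.eventually (eventually_le_nhds hε)
    filter_upwards [eventually_right_mem_Icc hs, hsmall] with t ⟨hst, ht⟩ hsm
    -- Jensen's inequality for `R`: a supporting functional at the increment reduces it to the
    -- integral of `ξ(z')`, and `ξ(z') ≤ R(z') ≤ σ(z')`. Freezing the force at `s` costs `(κ + Λ)(t
    -- - s)` per unit time.
    obtain ⟨ξ, hξ1, hξ2⟩ := hR.exists_support (z t - z s)
    have hii := hz'.intervalIntegrable hsI ht
    have h1 : (ξ - σ s) (z t - z s) = ∫ x in s..t, (ξ - σ s) (z' x) := by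
      rw [hz'.sub_eq hT.le hsI ht, ContinuousLinearMap.intervalIntegral_comp_comm _ hii]
    have h2 : ∫ x in s..t, (ξ - σ s) (z' x) ≤ ∫ x in s..t, (κ + Λ) * (t - s) := by
      rw [intervalIntegral.integral_of_le hst.le, intervalIntegral.integral_of_le hst.le]
      refine setIntegral_mono_ae_restrict
        (ContinuousLinearMap.integrable_comp _ hii.1) continuous_const.integrableOn_Ioc ?_
      have hsub : Ioc s t ⊆ Icc 0 T := fun x hx => ⟨hs.1.trans hx.1.le, hx.2.trans ht.2⟩
      filter_upwards [ae_restrict_of_ae_restrict_of_subset hsub hae,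
        ae_restrict_of_ae_restrict_of_subset hsub hbound, ae_restrict_mem measurableSet_Ioc]
        with x hx1 hx2 hx3
      have h3 := (hξ1 (z' x)).trans hx1.2
      have h4 := norm_force_sub_le hD hL hball hsI (hsub hx3) hx3.1.le
        (hlip s hsI x (hsub hx3) hx3.1.le)
      have h5 := dual_apply_le (σ x - σ s) (z' x)
      have h6 : ‖σ x - σ s‖ * ‖z' x‖ ≤ (κ + Λ) * (t - s) * 1 := by
        refine mul_le_mul (h4.trans ?_) hx2 (norm_nonneg _)
          (mul_nonneg (by linarith) (by linarith))
        exact mul_le_mul_of_nonneg_left (by linarith [hx3.2]) (by linarith)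
      simp only [hσ, _root_.sub_apply] at h3 h5 ⊢
      linarith
    rw [intervalIntegral.integral_const, smul_eq_mul] at h2
    have h7 := mul_le_mul_of_nonneg_left hsm (sub_pos.2 hst).le
    rw [_root_.sub_apply, hξ2] at h1
    change R (z t - z s) ≤ σ s (z t - z s) + (0 - 0) + ε * (t - s)
    linarith

-- Subadditivity of `R` lets the local power inequality accumulate from `s` to `t`. The price of
-- keeping the force frozen at `s` is its oscillation. The result involves no derivative and so
-- passes to the limit.
omit [CompleteSpace Z] in
theorem ApproxData.power_le (hD : IsEnergyDeriv r Λ C κ D H) (hR : IsSublinear ρ R) (hT : 0 < T)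
    (hL : ∀ s ∈ Icc 0 T, ∀ t ∈ Icc 0 T, ‖L s - L t‖ ≤ κ * |s - t|) {η : ℝ} {y : ℝ → Z}
    {σ p q : ℝ → StrongDual ℝ Z} {P B : ℝ → ℝ} (h : ApproxData T r z₀ L D R η y σ p q P B)
    {s t : ℝ} (hs : 0 ≤ s) (hst : s ≤ t) (ht : t ≤ T) :
    R (y t - y s) ≤ σ s (y t - y s) + (B t - B s)
      + ((κ + Λ) * (t - s) + 2 * η + 2 * η ^ 2) * (t - s) := by
  set c := (κ + Λ) * (t - s) + 2 * η + 2 * η ^ 2 with hc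
  have hsI : s ∈ Icc 0 T := ⟨hs, hst.trans ht⟩
  have hsub : Icc s t ⊆ Icc 0 T := Icc_subset_Icc hs ht
  have hΛ : 0 ≤ Λ := (norm_nonneg (H (y s))).trans (hD.bound _ (h.ball s hsI))
  have hyc : ContinuousOn (fun x => y x - y s) (Icc s t) :=
    (h.cont.mono hsub).sub continuousOn_const
  have key := le_of_right_increments
    (f := fun x => R (y x - y s) - σ s (y x - y s) - B x - c * x) hst
    ((((hR.continuous.comp_continuousOn hyc).sub (continuousOn_const.clm_apply hyc)).sub
      (h.cont_B.mono hsub)).sub (continuousOn_const.mul continuousOn_id)) ?_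
  · simp only [sub_self, hR.map_zero, _root_.map_zero] at key
    linarith
  intro x hx ε hε
  have hxT : x ∈ Ico 0 T := ⟨hs.trans hx.1, hx.2.trans_le ht⟩
  have hxI : x ∈ Icc 0 T := ⟨hxT.1, hxT.2.le⟩
  filter_upwards [h.right_lip x hxT, h.right_power x hxT ε hε, eventually_right_mem_Icc hxT]
    with u h1 h2 ⟨h3, h4⟩
  have e1 := hR.subadditive (y u - y x) (y x - y s)
  rw [sub_add_sub_cancel] at e1
  have e2 : ‖σ x - σ s‖ ≤ c := by
    rw [h.force x hxI, h.force s hsI]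
    have e3 := norm_force_sub_le hD hL h.ball hsI hxI hx.1
      (norm_sub_le_of_right_increments h.cont h.right_lip hs hx.1 hxI.2)
    have e4 : L x - D (y x) + p x + q x - (L s - D (y s) + p s + q s) =
      ((L x - D (y x)) - (L s - D (y s))) + ((p x - p s) + (q x - q s)) := by abel
    have e5 : (κ + Λ) * (x - s) ≤ (κ + Λ) * (t - s) ∨ κ + Λ < 0 := by
      rcases le_or_gt 0 (κ + Λ) with h0 | h0
      · exact Or.inl (mul_le_mul_of_nonneg_left (by linarith [hx.2]) h0)
      · exact Or.inr h0
    have e6 : 0 ≤ κ + Λ := by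
      have h5 := (norm_nonneg _).trans (hL 0 (left_mem_Icc.2 hT.le) T (right_mem_Icc.2 hT.le))
      rw [zero_sub, abs_neg, abs_of_pos hT] at h5
      have := nonneg_of_mul_nonneg_left h5 hT
      linarith
    have e7 := e5.resolve_right (not_lt.2 e6)
    rw [e4]
    have e8 := norm_add_le ((L x - D (y x)) - (L s - D (y s))) ((p x - p s) + (q x - q s))
    have e9 := norm_add_le (p x - p s) (q x - q s)
    linarith [norm_sub_le (p x) (p s), norm_sub_le (q x) (q s), h.p_le x hxI, h.p_le s hsI,
      h.q_le x hxI, h.q_le s hsI]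
  have e10 := (dual_apply_le (σ x - σ s) (y u - y x)).trans
    (mul_le_mul e2 h1 (norm_nonneg _) ((norm_nonneg _).trans e2))
  have e11 : σ s (y u - y s) - σ s (y x - y s) = σ s (y u - y x) := by
    rw [← map_sub]; congr 1; abel
  rw [_root_.sub_apply] at e10
  linarith

/-- Uniform limits of approximate solutions are solutions. -/
theorem exists_isStrongSolution (hD : IsEnergyDeriv r Λ C κ D H) (hC : 0 ≤ C) (hκ : 0 < κ)
    (hR : IsSublinear ρ R) (hT : 0 < T)
    (hL : ∀ s ∈ Icc 0 T, ∀ t ∈ Icc 0 T, ‖L s - L t‖ ≤ κ * |s - t|)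
    {η : ℕ → ℝ} (hη : Tendsto η atTop (𝓝 0)) {y : ℕ → ℝ → Z}
    (hy : ∀ n, IsApproxSolution T r z₀ L D R (η n) (y n)) :
    ∃ z : ℝ → Z, IsStrongSolution T z₀ L D R z := by
  choose σ p q P B hy using hy
  set K := 4 * (Real.exp (6 * C / κ * T) / κ) + 4 * T + 3 with hK
  have h0I : (0 : ℝ) ∈ Icc 0 T := left_mem_Icc.2 hT.le
  have hη0 : ∀ n, 0 ≤ η n := fun n => (norm_nonneg _).trans ((hy n).p_le 0 h0I)
  have hcauchy : ∀ t ∈ Icc 0 T, CauchySeq fun n => y n t := by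
    intro t ht
    rw [Metric.cauchySeq_iff]
    intro ε hε
    have h1 : Tendsto (fun n => K * η n) atTop (𝓝 0) := by simpa using hη.const_mul K
    obtain ⟨N, hN⟩ := eventually_atTop.1 (h1.eventually (gt_mem_nhds (half_pos hε)))
    refine ⟨N, fun m hm n hn => ?_⟩
    rw [dist_eq_norm]
    have := (hy m).norm_diff_le hD hC hκ hT (hy n) t ht
    linarith [hN m hm, hN n hn]
  have hlim : ∀ t : ℝ, ∃ l : Z, t ∈ Icc 0 T → Tendsto (fun n => y n t) atTop (𝓝 l) := by
    intro t
    by_cases ht : t ∈ Icc 0 T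
    · obtain ⟨l, hl⟩ := cauchySeq_tendsto_of_complete (hcauchy t ht)
      exact ⟨l, fun _ => hl⟩
    · exact ⟨0, fun h => absurd h ht⟩
  choose z₁ hz₁ using hlim
  -- Constant extension beyond the endpoints keeps the limit globally `1`-Lipschitz, as needed to
  -- form difference quotients up to `T`.
  set z : ℝ → Z := fun t => z₁ (projIcc 0 T hT.le t) with hzdef
  have hzI : ∀ t ∈ Icc 0 T, Tendsto (fun n => y n t) atTop (𝓝 (z t)) := by
    intro t ht
    simp only [hzdef, projIcc_of_mem hT.le ht]
    exact hz₁ t ht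
  have hlip : ∀ s ∈ Icc 0 T, ∀ t ∈ Icc 0 T, s ≤ t → ‖z t - z s‖ ≤ t - s := by
    intro s hs t ht hst
    exact le_of_tendsto ((hzI t ht).sub (hzI s hs)).norm (Eventually.of_forall fun n =>
      norm_sub_le_of_right_increments (hy n).cont (hy n).right_lip hs.1 hst ht.2)
  have hball : ∀ t ∈ Icc 0 T, ‖z t‖ ≤ r := fun t ht =>
    le_of_tendsto (hzI t ht).norm (Eventually.of_forall fun n => (hy n).ball t ht)
  have hzL : LipschitzWith 1 z := by
    have h1 : LipschitzOnWith 1 z₁ (Icc 0 T) := by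
      refine LipschitzOnWith.of_dist_le_mul fun s hs t ht => ?_
      have e : ∀ u ∈ Icc 0 T, z₁ u = z u := fun u hu => by
        simp only [hzdef, projIcc_of_mem hT.le hu]
      rw [e s hs, e t ht, dist_eq_norm, dist_eq_norm, NNReal.coe_one, one_mul, Real.norm_eq_abs]
      rcases le_total s t with hst | hst
      · rw [norm_sub_rev, abs_sub_comm]
        exact (hlip s hs t ht hst).trans (le_abs_self _)
      · exact (hlip t ht s hs hst).trans (le_abs_self _)
    have h2 : LipschitzWith (1 * 1) z := h1.to_restrict.comp (LipschitzWith.projIcc hT.le)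
    rwa [one_mul] at h2
  have hσlim : ∀ t ∈ Icc 0 T, Tendsto (fun n => σ n t) atTop (𝓝 (L t - D (z t))) := by
    intro t ht
    have h1 : Tendsto (fun n => p n t) atTop (𝓝 0) :=
      squeeze_zero_norm (fun n => (hy n).p_le t ht) hη
    have h2 : Tendsto (fun n => q n t) atTop (𝓝 0) :=
      squeeze_zero_norm (fun n => (hy n).q_le t ht) (by simpa using hη.pow 2)
    have h3 : Tendsto (fun n => D (y n t)) atTop (𝓝 (D (z t))) :=
      (hD.hasFDerivAt (z t)).continuousAt.tendsto.comp (hzI t ht)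
    have h4 := ((tendsto_const_nhds (x := L t)).sub h3).add h1 |>.add h2
    simp only [add_zero] at h4
    exact h4.congr fun n => ((hy n).force t ht).symm
  have hstable : ∀ t ∈ Icc 0 T, ∀ w, (L t - D (z t)) w ≤ R w := fun t ht w =>
    le_of_tendsto (((ContinuousLinearMap.apply ℝ ℝ w).continuous.tendsto _).comp (hσlim t ht))
      (Eventually.of_forall fun n => (hy n).stable t ht w)
  have hpower : ∀ s ∈ Icc 0 T, ∀ t ∈ Icc 0 T, s ≤ t → R (z t - z s) ≤
      (L s - D (z s)) (z t - z s) + (κ + Λ) * (t - s) * (t - s) := by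
    intro s hs t ht hst
    have hd := (hzI t ht).sub (hzI s hs)
    have hclm : ∀ {f : ℕ → StrongDual ℝ Z} {x : ℕ → Z} {f₀ : StrongDual ℝ Z} {x₀ : Z},
        Tendsto f atTop (𝓝 f₀) → Tendsto x atTop (𝓝 x₀) →
        Tendsto (fun n => f n (x n)) atTop (𝓝 (f₀ x₀)) := fun hf hx =>
      (isBoundedBilinearMap_apply.continuous.tendsto _).comp (hf.prodMk_nhds hx)
    have h1 : ∀ n, R (y n t - y n s) ≤ σ n s (y n t - y n s) + η n ^ 2
        + ((κ + Λ) * (t - s) + 2 * η n + 2 * η n ^ 2) * (t - s) := by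
      intro n
      have e1 := (hy n).power_le hD hR hT hL hs.1 hst ht.2
      have e2 := (hy n).B_le t ht
      have e3 : 0 ≤ B n s := by
        have := le_of_right_increments (f := fun x => -B n x) hs.1
          (((hy n).cont_B.mono (Icc_subset_Icc_right hs.2)).neg) ?_
        · simp only [(hy n).B_zero] at this; linarith
        intro x hx ε hε
        filter_upwards [(hy n).right_B x ⟨hx.1, hx.2.trans_le hs.2⟩, self_mem_nhdsWithin]
          with u hu (hu' : x < u)
        have : 0 ≤ ε * (u - x) := mul_nonneg hε.le (sub_nonneg.2 hu'.le)
        linarith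
      linarith
    have h2 : Tendsto (fun n => σ n s (y n t - y n s) + η n ^ 2
        + ((κ + Λ) * (t - s) + 2 * η n + 2 * η n ^ 2) * (t - s)) atTop
        (𝓝 ((L s - D (z s)) (z t - z s) + 0 ^ 2
          + ((κ + Λ) * (t - s) + 2 * 0 + 2 * 0 ^ 2) * (t - s))) :=
      ((hclm (hσlim s hs) hd).add (hη.pow 2)).add
        (((tendsto_const_nhds.add (hη.const_mul 2)).add ((hη.pow 2).const_mul 2)).mul_const _)
    have h3 := le_of_tendsto_of_tendsto ((hR.continuous.tendsto _).comp hd) h2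
      (Eventually.of_forall h1)
    simpa using h3
  obtain ⟨z', hz'⟩ := exists_sobolevDeriv_of_lipschitz (T := T) hzL
  refine ⟨z, z', hz', tendsto_nhds_unique (hzI 0 h0I) ?_, ?_⟩
  · simp only [(hy _).init]; exact tendsto_const_nhds
  filter_upwards [hz'.ae_hasDerivAt hT.le] with t ⟨htI, htd⟩
  have htI' : t ∈ Icc 0 T := ⟨htI.1.le, htI.2.le⟩
  refine ⟨hstable t htI', ?_⟩
  -- The limiting power inequality on `[t, s]` is divided by `s - t`; its quadratic error disappears
  -- as `s` decreases to `t`.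
  have hs := (hasDerivAt_iff_tendsto_slope.1 htd).mono_left
    (nhdsWithin_mono t (fun s (hs : t < s) => ne_of_gt hs) : 𝓝[>] t ≤ 𝓝[≠] t)
  have h1 : Tendsto (fun s => (L t - D (z t)) (slope z t s) + (κ + Λ) * (s - t)) (𝓝[>] t)
      (𝓝 ((L t - D (z t)) (z' t) + (κ + Λ) * (t - t))) := by
    have h2 : Continuous fun s => (κ + Λ) * (s - t) := by fun_prop
    exact (((L t - D (z t)).continuous.tendsto _).comp hs).add
      ((h2.tendsto t).mono_left nhdsWithin_le_nhds)
  have h3 := le_of_tendsto_of_tendsto ((hR.continuous.tendsto _).comp hs) h1 ?_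
  · simpa using h3
  filter_upwards [Ioo_mem_nhdsGT htI.2] with s hsI
  have hst : 0 < s - t := sub_pos.2 hsI.1
  have h4 := hpower t htI' s ⟨htI.1.le.trans hsI.1.le, hsI.2.le⟩ hsI.1.le
  have h5 : z s - z t = (s - t) • slope z t s := by
    rw [slope_def_module, smul_smul, mul_inv_cancel₀ hst.ne', one_smul]
  rw [h5, hR.homogeneous _ hst, map_smul, smul_eq_mul] at h4
  simp only [Function.comp_apply]
  nlinarith

end StrongSolution

/-! ### Piecewise affine interpolation on the grid of physical times -/

section Interp

variable {E : Type*} [NormedAddCommGroup E] [NormedSpace ℝ E]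

/-- The continuous, piecewise affine function with value `x k` at `t k` for `k ≤ N`. -/
noncomputable def interp (t : ℕ → ℝ) (N : ℕ) (x : ℕ → E) (r : ℝ) : E :=
  x 0 + ∑ i ∈ Finset.range N, max 0 (min 1 ((r - t i) / (t (i + 1) - t i))) • (x (i + 1) - x i)

theorem continuous_interp (t : ℕ → ℝ) (N : ℕ) (x : ℕ → E) : Continuous (interp t N x) := by
  unfold interp
  refine continuous_const.add (continuous_finsetSum _ fun i _ => ?_)
  exact (continuous_const.max (continuous_const.min
    ((continuous_id.sub continuous_const).div_const _))).smul continuous_const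

theorem interp_sub (t : ℕ → ℝ) (N : ℕ) (x y : ℕ → E) (r : ℝ) :
    interp t N (fun k => x k - y k) r = interp t N x r - interp t N y r := by
  unfold interp
  rw [add_sub_add_comm, ← Finset.sum_sub_distrib]
  congr 1
  refine Finset.sum_congr rfl fun i _ => ?_
  rw [← smul_sub, sub_sub_sub_comm]

theorem le_of_grid {t : ℕ → ℝ} {N : ℕ} (ht : ∀ k < N, t k < t (k + 1)) {i j : ℕ}
    (hij : i ≤ j) (hj : j ≤ N) : t i ≤ t j := by
  induction j, hij using Nat.le_induction with
  | base => exact le_rfl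
  | succ k _ ih => exact (ih (by omega)).trans (ht k (by omega)).le

/-- The clamped weights equal one on all earlier cells and zero on all later ones, so the sum
telescopes. -/
theorem interp_of_mem {t : ℕ → ℝ} {N : ℕ} (ht : ∀ k < N, t k < t (k + 1)) (x : ℕ → E) {k : ℕ}
    (hk : k < N) {r : ℝ} (hr : r ∈ Icc (t k) (t (k + 1))) :
    interp t N x r = x k + ((r - t k) / (t (k + 1) - t k)) • (x (k + 1) - x k) := by
  unfold interp
  rw [← Finset.sum_subset (Finset.range_subset_range.2 hk), Finset.sum_range_succ, ← add_assoc]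
  · have h1 : ∑ i ∈ Finset.range k, max 0 (min 1 ((r - t i) / (t (i + 1) - t i))) •
        (x (i + 1) - x i) = x k - x 0 := by
      rw [← Finset.sum_range_sub]
      refine Finset.sum_congr rfl fun i hi => ?_
      have hi' := Finset.mem_range.1 hi
      have h2 := ht i (by omega)
      have h3 : t (i + 1) ≤ t k := le_of_grid ht hi' hk.le
      have h4 : 1 ≤ (r - t i) / (t (i + 1) - t i) := by
        rw [one_le_div (sub_pos.2 h2)]; linarith [hr.1]
      rw [min_eq_left h4, max_eq_right zero_le_one, one_smul]
    have h0 := ht k hk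
    have h5 : (r - t k) / (t (k + 1) - t k) ≤ 1 := by
      rw [div_le_one (sub_pos.2 h0)]; linarith [hr.2]
    have h6 : 0 ≤ (r - t k) / (t (k + 1) - t k) :=
      div_nonneg (sub_nonneg.2 hr.1) (sub_pos.2 h0).le
    rw [h1, min_eq_right h5, max_eq_right h6, add_sub_cancel]
  · intro i hi hik
    have hiN := Finset.mem_range.1 hi
    have hki : k + 1 ≤ i := by
      by_contra hc
      exact hik (Finset.mem_range.2 (by omega))
    have h2 := ht i hiN
    have h3 : t (k + 1) ≤ t i := le_of_grid ht hki hiN.le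
    have h4 : (r - t i) / (t (i + 1) - t i) ≤ 0 :=
      div_nonpos_of_nonpos_of_nonneg (by linarith [hr.2]) (sub_pos.2 h2).le
    rw [max_eq_left ((min_le_right _ _).trans h4), zero_smul]

theorem interp_sub_of_mem {t : ℕ → ℝ} {N : ℕ} (ht : ∀ k < N, t k < t (k + 1)) (x : ℕ → E) {k : ℕ}
    (hk : k < N) {r s : ℝ} (hr : r ∈ Icc (t k) (t (k + 1))) (hs : s ∈ Icc (t k) (t (k + 1))) :
    interp t N x r - interp t N x s = ((r - s) / (t (k + 1) - t k)) • (x (k + 1) - x k) := by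
  rw [interp_of_mem ht x hk hr, interp_of_mem ht x hk hs, add_sub_add_left_eq_sub, ← sub_smul,
    ← sub_div, sub_sub_sub_cancel_right]

theorem interp_left {t : ℕ → ℝ} {N : ℕ} (ht : ∀ k < N, t k < t (k + 1)) (x : ℕ → E) {k : ℕ}
    (hk : k < N) : interp t N x (t k) = x k := by
  rw [interp_of_mem ht x hk (left_mem_Icc.2 (ht k hk).le)]
  simp

theorem interp_right {t : ℕ → ℝ} {N : ℕ} (ht : ∀ k < N, t k < t (k + 1)) (x : ℕ → E) {k : ℕ}
    (hk : k < N) : interp t N x (t (k + 1)) = x (k + 1) := by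
  rw [interp_of_mem ht x hk (right_mem_Icc.2 (ht k hk).le), div_self (sub_pos.2 (ht k hk)).ne']
  simp

theorem exists_cell {t : ℕ → ℝ} {N : ℕ} {s : ℝ} (h0 : t 0 ≤ s) (hN : s < t N) :
    ∃ k < N, t k ≤ s ∧ s < t (k + 1) := by
  classical
  have hex : ∃ k, s < t k := ⟨N, hN⟩
  have h1 : Nat.find hex ≠ 0 := fun h => by
    have := Nat.find_spec hex
    rw [h] at this
    exact absurd h0 (not_le.2 this)
  obtain ⟨k, hk⟩ := Nat.exists_eq_succ_of_ne_zero h1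
  have h2 : Nat.find hex ≤ N := Nat.find_min' hex hN
  refine ⟨k, by omega, not_lt.1 (Nat.find_min hex (by omega)), ?_⟩
  have := Nat.find_spec hex
  rwa [hk] at this

theorem exists_closed_cell {t : ℕ → ℝ} {N : ℕ} (ht : ∀ k < N, t k < t (k + 1)) {s : ℝ}
    (h0 : t 0 ≤ s) (hsN : s ≤ t N) (hlt : t 0 < t N) :
    ∃ k < N, s ∈ Icc (t k) (t (k + 1)) := by
  rcases hsN.eq_or_lt with rfl | h
  · obtain ⟨k, rfl⟩ : ∃ k, N = k + 1 := by
      refine Nat.exists_eq_succ_of_ne_zero ?_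
      rintro rfl
      exact lt_irrefl _ hlt
    exact ⟨k, by omega, (ht k (by omega)).le, le_rfl⟩
  · obtain ⟨k, hk, h1, h2⟩ := exists_cell h0 h
    exact ⟨k, hk, h1, h2.le⟩

end Interp

/-! ### The implicit incremental scheme and its order of consistency -/

section Incremental

variable {Z : Type*} [NormedAddCommGroup Z] [InnerProductSpace ℝ Z]
  {r Λ C κ ρ T τ : ℝ} {D : Z → StrongDual ℝ Z} {H : Z → Z →L[ℝ] StrongDual ℝ Z}
  {L : ℝ → StrongDual ℝ Z} {R : Z → ℝ} {z₀ : Z} {t : ℕ → ℝ} {y : ℕ → Z} {N : ℕ}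

/-- Solutions of the implicit incremental scheme on a time grid with step size at most `τ`. -/
structure IsIncremental (T : ℝ) (z₀ : Z) (L : ℝ → StrongDual ℝ Z) (D : Z → StrongDual ℝ Z)
    (R : Z → ℝ) (τ : ℝ) (N : ℕ) (t : ℕ → ℝ) (y : ℕ → Z) : Prop where
  t_zero : t 0 = 0
  t_last : t N = T
  t_lt : ∀ k < N, t k < t (k + 1)
  t_step : ∀ k < N, t (k + 1) - t k ≤ τ
  init : y 0 = z₀
  lip : ∀ k < N, ‖y (k + 1) - y k‖ ≤ t (k + 1) - t k
  stable : ∀ k ≤ N, ∀ w, (L (t k) - D (y k)) w ≤ R w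
  power : ∀ k < N, R (y (k + 1) - y k) ≤ (L (t (k + 1)) - D (y (k + 1))) (y (k + 1) - y k)

/-- `L` has a derivative `m` whose variation is controlled by the function `V`. -/
structure IsLoad (T κ : ℝ) (L m : ℝ → StrongDual ℝ Z) (V : ℝ → ℝ) : Prop where
  lip : ∀ s ∈ Icc 0 T, ∀ t ∈ Icc 0 T, ‖L s - L t‖ ≤ κ * |s - t|
  mono : MonotoneOn V (Icc 0 T)
  taylor : ∀ a b c s t : ℝ, 0 ≤ a → b ≤ T → a ≤ s → s ≤ t → t ≤ b → c ∈ Icc a b →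
    ‖L t - L s - (t - s) • m c‖ ≤ (t - s) * (V b - V a)

theorem IsIncremental.mem_Icc (h : IsIncremental T z₀ L D R τ N t y) {k : ℕ} (hk : k ≤ N) :
    t k ∈ Icc 0 T := by
  rw [← h.t_zero, ← h.t_last]
  exact ⟨le_of_grid h.t_lt (Nat.zero_le k) hk, le_of_grid h.t_lt hk le_rfl⟩

theorem IsIncremental.norm_le (h : IsIncremental T z₀ L D R τ N t y) (hr : ‖z₀‖ + T ≤ r) {k : ℕ}
    (hk : k ≤ N) : ‖y k‖ ≤ r := by
  have : ∀ k ≤ N, ‖y k‖ ≤ ‖z₀‖ + t k := by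
    intro k
    induction k with
    | zero => intro _; rw [h.init, h.t_zero, add_zero]
    | succ k ih =>
      intro hk
      have h1 := ih (by omega)
      have h2 := h.lip k (by omega)
      have h3 := norm_le_norm_add_norm_sub' (y (k + 1)) (y k)
      linarith
  linarith [this k hk, (h.mem_Icc hk).2]

/-- Estimate of the second difference of the driving force in one time step. -/
theorem second_difference_le (hD : IsEnergyDeriv r Λ C κ D H) (hC : 0 ≤ C) (hκ : 0 ≤ κ)
    {x v u : Z} {h : ℝ} (hh : 0 < h) (hx : ‖x‖ ≤ r) (hx' : ‖x + h • v‖ ≤ r) (hv : ‖v‖ ≤ 1)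
    (hu : ‖u‖ ≤ 1) (l : StrongDual ℝ Z)
    (hneg : (h • l - (D (x + h • v) - D x)) u ≤ 0) :
    (h • l - (D (x + h • v) - D x)) v ≤
      h * (l v - l u - H (x + h • v) v v / 2 + H x u u / 2 + 3 * C * h) := by
  set x' := x + h • v with hx'def
  have hxx : x' - x = h • v := by simp [hx'def]
  have hnorm : ‖x' - x‖ ≤ h := by
    rw [hxx, norm_smul, Real.norm_of_nonneg hh.le]
    exact mul_le_of_le_one_right hh.le hv
  -- By `hneg`, replacing the test vector `v` by `v - u` only increases the left side. In the
  -- application `v` is the current discrete velocity and `u` the previous one.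
  have e1 : (h • l - (D x' - D x)) (v - u) ≤ h * (l (v - u) - H x v (v - u)) + 2 * C * h ^ 2 := by
    have t := hD.taylor hC hx' hx
    rw [hxx, map_smul] at t
    have t1 : -(D x' - D x - h • H x v) (v - u) ≤ (C * h ^ 2) * 2 := by
      rw [← _root_.neg_apply]
      refine (dual_apply_le _ _).trans (mul_le_mul ?_ ?_ (norm_nonneg _) (by positivity))
      · rw [norm_neg]
        refine t.trans (mul_le_mul_of_nonneg_left ?_ hC)
        rw [← hxx]
        exact pow_le_pow_left₀ (norm_nonneg _) hnorm 2
      · linarith [norm_sub_le v u]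
    simp only [_root_.sub_apply, _root_.smul_apply, smul_eq_mul] at t1 ⊢
    linarith
  -- Convexity turns `H(v, v - u)` into half a difference of squares, which telescopes over the
  -- steps.
  have e2 : H x v u ≤ H x v v / 2 + H x u u / 2 := by
    have c := (by positivity : 0 ≤ κ * ‖v - u‖ ^ 2).trans (hD.coercive x (v - u))
    have s := hD.symm x u v
    simp only [map_sub, _root_.sub_apply] at c
    linarith
  -- The new square is moved to the new base point, where the next step expects it.
  have e3 : H x' v v - H x v v ≤ C * h := by
    have c := bilin_apply_le (H x' - H x) v v
    have c1 := (hD.lipschitz x' x hx' hx).trans (mul_le_mul_of_nonneg_left hnorm hC)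
    have c2 : ‖v‖ * ‖v‖ ≤ 1 := mul_le_one₀ hv (norm_nonneg _) hv
    have c3 := mul_le_mul c1 c2 (by positivity) (by positivity)
    simp only [_root_.sub_apply] at c
    linarith
  have e4 := mul_le_mul_of_nonneg_left e2 hh.le
  have e5 := mul_le_mul_of_nonneg_left e3 hh.le
  simp only [map_sub] at e1
  nlinarith [mul_nonneg hC (sq_nonneg h)]

/-- Bounding each term by `O(d²)`, with `d` the step length, would give only `O(τ)` for the sum. The
terms divided by `d²` have a bounded sum: the Hessian squares telescope, and summation by parts in
the load leaves the variation of its difference quotients. -/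
theorem IsIncremental.sum_increments_le (hD : IsEnergyDeriv r Λ C κ D H) (hC : 0 ≤ C)
    (hκ : 0 ≤ κ) (hR : IsSublinear ρ R) (hr : ‖z₀‖ + T ≤ r)
    {m : ℝ → StrongDual ℝ Z} {V : ℝ → ℝ} (hL : IsLoad T κ L m V)
    (h : IsIncremental T z₀ L D R τ N t y) {n : ℕ} (hn : n ≤ N) :
    ∑ k ∈ Finset.range n, ((L (t (k + 1)) - D (y (k + 1))) - (L (t k) - D (y k)))
      (y (k + 1) - y k) ≤ (κ + 2 * (V T - V 0) + 3 * C * T) * τ ^ 2 := by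
  set σ : ℕ → StrongDual ℝ Z := fun k => L (t k) - D (y k) with hσ
  set d : ℕ → ℝ := fun k => t (k + 1) - t k with hd
  set v : ℕ → Z := fun k => (d k)⁻¹ • (y (k + 1) - y k) with hv
  set l : ℕ → StrongDual ℝ Z := fun k => (d k)⁻¹ • (L (t (k + 1)) - L (t k)) with hl
  set a : ℕ → ℝ := fun k => (σ (k + 1) - σ k) (v k) / d k with ha
  have hd0 : ∀ k < N, 0 < d k := fun k hk => sub_pos.2 (h.t_lt k hk)
  have hyv : ∀ k < N, y (k + 1) = y k + d k • v k := by
    intro k hk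
    simp only [hv, smul_smul, mul_inv_cancel₀ (hd0 k hk).ne', one_smul, add_sub_cancel]
  have hv1 : ∀ k < N, ‖v k‖ ≤ 1 := by
    intro k hk
    simp only [hv, norm_smul, norm_inv, Real.norm_of_nonneg (hd0 k hk).le]
    rw [inv_mul_le_iff₀ (hd0 k hk), mul_one]
    exact h.lip k hk
  have hσl : ∀ k < N, σ (k + 1) - σ k = d k • l k - (D (y k + d k • v k) - D (y k)) := by
    intro k hk
    rw [← hyv k hk]
    simp only [hl, hσ, smul_smul, mul_inv_cancel₀ (hd0 k hk).ne', one_smul]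
    abel
  have hstep : ∀ k < N, ∀ u : Z, ‖u‖ ≤ 1 → (σ (k + 1) - σ k) u ≤ 0 →
      a k ≤ l k (v k) - l k u - H (y (k + 1)) (v k) (v k) / 2 + H (y k) u u / 2
        + 3 * C * d k := by
    intro k hk u hu hneg
    have hx' : ‖y k + d k • v k‖ ≤ r := by rw [← hyv k hk]; exact h.norm_le hr hk
    rw [hσl k hk] at hneg
    have := second_difference_le hD hC hκ (hd0 k hk) (h.norm_le hr hk.le) hx' (hv1 k hk) hu
      (l k) hneg
    rw [← hσl k hk, ← hyv k hk] at this
    simp only [ha]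
    rw [div_le_iff₀ (hd0 k hk)]
    linarith
  have hm : ∀ k < N, ∀ c ∈ Icc (t k) (t (k + 1)), ‖l k - m c‖ ≤ V (t (k + 1)) - V (t k) := by
    intro k hk c hc
    have := hL.taylor (t k) (t (k + 1)) c (t k) (t (k + 1)) (h.mem_Icc hk.le).1
      (h.mem_Icc hk).2 le_rfl (h.t_lt k hk).le le_rfl hc
    have e : l k - m c = (d k)⁻¹ • (L (t (k + 1)) - L (t k) - d k • m c) := by
      simp only [hl, smul_sub, smul_smul, inv_mul_cancel₀ (hd0 k hk).ne', one_smul]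
    rw [e, norm_smul, norm_inv, Real.norm_of_nonneg (hd0 k hk).le, inv_mul_le_iff₀ (hd0 k hk)]
    exact this
  have hV : ∀ i j, i ≤ j → j ≤ N → V (t i) ≤ V (t j) := fun i j hij hj =>
    hL.mono (h.mem_Icc (hij.trans hj)) (h.mem_Icc hj) (le_of_grid h.t_lt hij hj)
  -- Comparing consecutive load quotients costs the variation over two adjacent cells, so the cells
  -- overlap and two values of `V` survive the telescoping.
  have hsum : ∀ k < N, ∑ i ∈ Finset.range (k + 1), a i ≤ l k (v k)
      - H (y (k + 1)) (v k) (v k) / 2 + (V (t (k + 1)) + V (t k) - 2 * V (t 0))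
      + 3 * C * t (k + 1) := by
    intro k
    induction k with
    | zero =>
      intro hk
      -- The first step has no previous velocity and is compared with zero.
      have := hstep 0 hk 0 (by simp) (by simp)
      have h1 := hV 0 1 (by omega) hk
      simp only [_root_.map_zero, hd, h.t_zero, zero_add] at this
      simp only [zero_add, Finset.sum_range_one]
      linarith
    | succ k ih =>
      intro hk
      have ih' := ih (by omega)
      have hk' : k < N := by omega
      rw [Finset.sum_range_succ]
      -- The old velocity is optimal for the old force and merely admissible for the new, stable
      -- one.
      have hneg : (σ (k + 1 + 1) - σ (k + 1)) (v k) ≤ 0 := by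
        have e1 := h.stable (k + 2) hk (v k)
        have e2 : R (v k) ≤ σ (k + 1) (v k) := by
          simp only [hv, map_smul, smul_eq_mul]
          rw [hR.homogeneous _ (inv_pos.2 (hd0 k hk'))]
          exact mul_le_mul_of_nonneg_left (h.power k hk') (inv_pos.2 (hd0 k hk')).le
        rw [_root_.sub_apply]
        exact sub_nonpos.2 (e1.trans e2)
      have e3 := hstep (k + 1) hk (v k) (hv1 k hk') hneg
      have e4 : (l k - l (k + 1)) (v k) ≤ V (t (k + 2)) - V (t k) := by
        have f1 := hm k hk' (t (k + 1)) (right_mem_Icc.2 (h.t_lt k hk').le)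
        have f2 := hm (k + 1) hk (t (k + 1)) (left_mem_Icc.2 (h.t_lt (k + 1) hk).le)
        have f3 : ‖l k - l (k + 1)‖ ≤ V (t (k + 2)) - V (t k) := by
          have : l k - l (k + 1) = (l k - m (t (k + 1))) - (l (k + 1) - m (t (k + 1))) := by abel
          rw [this]
          exact (norm_sub_le _ _).trans (by linarith)
        exact (dual_apply_le _ _).trans
          ((mul_le_of_le_one_right (norm_nonneg _) (hv1 k hk')).trans f3)
      rw [_root_.sub_apply] at e4
      have e5 : d (k + 1) = t (k + 2) - t (k + 1) := rfl
      rw [e5] at e3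
      linarith
  -- Nonnegativity of `a k`, from stability and power, allows `d²` to be enlarged to `τ²`.
  have hβ : ∀ k < N, (σ (k + 1) - σ k) (y (k + 1) - y k) ≤ τ ^ 2 * a k := by
    intro k hk
    have e1 : (σ (k + 1) - σ k) (y (k + 1) - y k) = d k ^ 2 * a k := by
      rw [hyv k hk, add_sub_cancel_left, map_smul, smul_eq_mul]
      simp only [ha]
      field_simp [(hd0 k hk).ne']
    have e2 : 0 ≤ (σ (k + 1) - σ k) (y (k + 1) - y k) := by
      have := (h.stable k hk.le (y (k + 1) - y k)).trans (h.power k hk)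
      rw [_root_.sub_apply]
      exact sub_nonneg.2 this
    rw [e1] at e2 ⊢
    have e3 : 0 ≤ a k := nonneg_of_mul_nonneg_right e2 (pow_pos (hd0 k hk) 2)
    exact mul_le_mul_of_nonneg_right (pow_le_pow_left₀ (hd0 k hk).le (h.t_step k hk) 2) e3
  have h0T := h.mem_Icc (Nat.zero_le N)
  have hT0 : 0 ≤ T := h0T.1.trans h0T.2
  have hV0 : V 0 ≤ V T := hL.mono (left_mem_Icc.2 hT0) (right_mem_Icc.2 hT0) hT0
  rcases n with _ | n
  · simp only [Finset.range_zero, Finset.sum_empty]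
    have : 0 ≤ V T - V 0 := sub_nonneg.2 hV0
    positivity
  · have hs := hsum n hn
    have e1 : l n (v n) ≤ κ := by
      refine (dual_apply_le _ _).trans
        ((mul_le_of_le_one_right (norm_nonneg _) (hv1 n hn)).trans ?_)
      have := hL.lip _ (h.mem_Icc hn) _ (h.mem_Icc (Nat.le_of_succ_le hn))
      rw [abs_of_pos (hd0 n hn)] at this
      simp only [hl, norm_smul, norm_inv, Real.norm_of_nonneg (hd0 n hn).le]
      rw [inv_mul_le_iff₀ (hd0 n hn), mul_comm]
      exact this
    have e2 := (by positivity : 0 ≤ κ * ‖v n‖ ^ 2).trans (hD.coercive (y (n + 1)) (v n))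
    have hn' : n ≤ N := Nat.le_of_succ_le hn
    have e3 := hV (n + 1) N hn le_rfl
    have e4 := hV n N hn' le_rfl
    have e5 := mul_le_mul_of_nonneg_left (h.mem_Icc hn).2 (by positivity : 0 ≤ 3 * C)
    rw [h.t_last] at e3 e4
    rw [h.t_zero] at hs
    calc _ ≤ ∑ k ∈ Finset.range (n + 1), τ ^ 2 * a k :=
          Finset.sum_le_sum fun k hk => hβ k (by have := Finset.mem_range.1 hk; omega)
      _ = τ ^ 2 * ∑ k ∈ Finset.range (n + 1), a k := by rw [Finset.mul_sum]
      _ ≤ τ ^ 2 * (κ + 2 * (V T - V 0) + 3 * C * T) :=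
          mul_le_mul_of_nonneg_left (by linarith) (sq_nonneg τ)
      _ = _ := mul_comm _ _

/-- The piecewise affine interpolant of an incremental solution is an approximate solution. -/
theorem IsIncremental.isApproxSolution (hD : IsEnergyDeriv r Λ C κ D H) (hC : 0 ≤ C)
    (hκ : 0 ≤ κ) (hR : IsSublinear ρ R) (hT : 0 < T) (hr : ‖z₀‖ + T ≤ r)
    {m : ℝ → StrongDual ℝ Z} {V : ℝ → ℝ} (hL : IsLoad T κ L m V)
    (h : IsIncremental T z₀ L D R τ N t y) :
    IsApproxSolution T r z₀ L D R
      ((1 + 2 * C + κ + 2 * (V T - V 0) + 3 * C * T) * τ) (interp t N y) := by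
  set σ : ℕ → StrongDual ℝ Z := fun k => L (t k) - D (y k) with hσ
  set β : ℕ → ℝ := fun k => (σ (k + 1) - σ k) (y (k + 1) - y k) with hβ
  set Pk : ℕ → ℝ := fun n => ∑ k ∈ Finset.range n,
    2 * (t (k + 1) - t k) * (V (t (k + 1)) - V (t k)) with hPk
  set Bk : ℕ → ℝ := fun n => ∑ k ∈ Finset.range n, β k with hBk
  -- The sum covers the constants of `q`, `P` and the power defect; the summand one ensures `c ≤
  -- c²`, hence `cτ² ≤ (cτ)²`.
  set c := 1 + 2 * C + κ + 2 * (V T - V 0) + 3 * C * T with hc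
  have hV0 : 0 ≤ V T - V 0 :=
    sub_nonneg.2 (hL.mono (left_mem_Icc.2 hT.le) (right_mem_Icc.2 hT.le) hT.le)
  have hCT : 0 ≤ C * T := mul_nonneg hC hT.le
  have hc1 : 1 ≤ c := by simp only [hc]; linarith
  have hlt : t 0 < t N := by rw [h.t_zero, h.t_last]; exact hT
  have hcell : ∀ s ∈ Icc 0 T, ∃ k < N, s ∈ Icc (t k) (t (k + 1)) := fun s hs =>
    exists_closed_cell h.t_lt (h.t_zero.trans_le hs.1) (hs.2.trans_eq h.t_last.symm) hlt
  have h0N : 0 < N := Nat.pos_of_ne_zero fun h0 => by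
    rw [h0] at hlt
    exact lt_irrefl _ hlt
  have hτ : 0 ≤ τ := by linarith [h.t_step 0 h0N, h.t_lt 0 h0N]
  have hcc : c * τ ^ 2 ≤ (c * τ) ^ 2 := by
    rw [mul_pow]
    exact mul_le_mul_of_nonneg_right (by nlinarith) (sq_nonneg τ)
  have hd0 : ∀ k < N, 0 < t (k + 1) - t k := fun k hk => sub_pos.2 (h.t_lt k hk)
  have hVk : ∀ k < N, V (t k) ≤ V (t (k + 1)) := fun k hk =>
    hL.mono (h.mem_Icc hk.le) (h.mem_Icc hk) (h.t_lt k hk).le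
  have hβ0 : ∀ k < N, 0 ≤ β k := by
    intro k hk
    have := (h.stable k hk.le (y (k + 1) - y k)).trans (h.power k hk)
    simp only [hβ, _root_.sub_apply]
    exact sub_nonneg.2 this
  have hθ : ∀ k < N, ∀ s ∈ Icc (t k) (t (k + 1)), 0 ≤ (s - t k) / (t (k + 1) - t k) ∧
      (s - t k) / (t (k + 1) - t k) ≤ 1 := by
    intro k hk s hs
    refine ⟨div_nonneg (sub_nonneg.2 hs.1) (hd0 k hk).le, ?_⟩
    rw [div_le_one (hd0 k hk)]
    linarith [hs.2]
  have hPkle : ∀ n ≤ N, Pk n ≤ 2 * (V T - V 0) * τ := by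
    have : ∀ n ≤ N, Pk n ≤ 2 * (V (t n) - V 0) * τ := by
      intro n
      induction n with
      | zero => intro _; simp [hPk, h.t_zero]
      | succ n ih =>
        intro hn
        have e1 := ih (by omega)
        have e2 := mul_le_mul_of_nonneg_right (h.t_step n hn) (sub_nonneg.2 (hVk n hn))
        have e3 : Pk (n + 1) = Pk n + 2 * (t (n + 1) - t n) * (V (t (n + 1)) - V (t n)) := by
          simp only [hPk, Finset.sum_range_succ]
        rw [e3]
        linarith
    intro n hn
    refine (this n hn).trans (mul_le_mul_of_nonneg_right ?_ hτ)
    have := hL.mono (h.mem_Icc hn) (right_mem_Icc.2 hT.le) (h.mem_Icc hn).2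
    linarith
  have hBkle : ∀ n ≤ N, Bk n ≤ c * τ ^ 2 := by
    intro n hn
    refine (h.sum_increments_le hD hC hκ hR hr hL hn).trans
      (mul_le_mul_of_nonneg_right ?_ (sq_nonneg τ))
    simp only [hc]; linarith
  have hPinc : ∀ k < N, ∀ s ∈ Icc (t k) (t (k + 1)), ∀ u ∈ Icc (t k) (t (k + 1)),
      interp t N Pk u - interp t N Pk s = 2 * (u - s) * (V (t (k + 1)) - V (t k)) := by
    intro k hk s hs u hu
    rw [interp_sub_of_mem h.t_lt Pk hk hu hs]
    have e3 : Pk (k + 1) - Pk k = 2 * (t (k + 1) - t k) * (V (t (k + 1)) - V (t k)) := by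
      simp only [hPk, Finset.sum_range_succ, add_sub_cancel_left]
    rw [e3, smul_eq_mul]
    have := (hd0 k hk).ne'
    field_simp
  have hBinc : ∀ k < N, ∀ s ∈ Icc (t k) (t (k + 1)), ∀ u ∈ Icc (t k) (t (k + 1)),
      interp t N Bk u - interp t N Bk s = (u - s) / (t (k + 1) - t k) * β k := by
    intro k hk s hs u hu
    rw [interp_sub_of_mem h.t_lt Bk hk hu hs, smul_eq_mul]
    simp only [hBk, Finset.sum_range_succ, add_sub_cancel_left]
  have hLc : ContinuousOn L (Icc 0 T) := continuousOn_of_lipschitz_bound hL.lip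
  have hpinc : ∀ k < N, ∀ s ∈ Icc (t k) (t (k + 1)), ∀ u ∈ Icc (t k) (t (k + 1)), s ≤ u →
      ‖(interp t N (L ∘ t) u - L u) - (interp t N (L ∘ t) s - L s)‖
        ≤ interp t N Pk u - interp t N Pk s := by
    intro k hk s hs u hu hsu
    rw [hPinc k hk s hs u hu]
    have e1 := interp_sub_of_mem h.t_lt (L ∘ t) hk hu hs
    have e2 := hL.taylor (t k) (t (k + 1)) (t k) (t k) (t (k + 1)) (h.mem_Icc hk.le).1
      (h.mem_Icc hk).2 le_rfl (h.t_lt k hk).le le_rfl (left_mem_Icc.2 (h.t_lt k hk).le)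
    have e3 := hL.taylor (t k) (t (k + 1)) (t k) s u (h.mem_Icc hk.le).1
      (h.mem_Icc hk).2 hs.1 hsu hu.2 (left_mem_Icc.2 (h.t_lt k hk).le)
    have e4 : (interp t N (L ∘ t) u - L u) - (interp t N (L ∘ t) s - L s) =
        ((u - s) / (t (k + 1) - t k)) •
          (L (t (k + 1)) - L (t k) - (t (k + 1) - t k) • m (t k))
        - (L u - L s - (u - s) • m (t k)) := by
      rw [smul_sub, smul_smul, div_mul_cancel₀ _ (hd0 k hk).ne']
      simp only [Function.comp_apply] at e1
      rw [← e1]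
      abel
    rw [e4]
    refine (norm_sub_le _ _).trans ?_
    rw [norm_smul, Real.norm_of_nonneg (div_nonneg (sub_nonneg.2 hsu) (hd0 k hk).le)]
    have e5 := mul_le_mul_of_nonneg_left e2 (div_nonneg (sub_nonneg.2 hsu) (hd0 k hk).le)
    have e6 : (u - s) / (t (k + 1) - t k) * ((t (k + 1) - t k) * (V (t (k + 1)) - V (t k)))
        = (u - s) * (V (t (k + 1)) - V (t k)) := by
      have := (hd0 k hk).ne'
      field_simp
    linarith
  have hPle : ∀ s ∈ Icc 0 T, interp t N Pk s ≤ 2 * (V T - V 0) * τ := by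
    intro s hs
    obtain ⟨k, hk, hsk⟩ := hcell s hs
    have e1 := hPinc k hk s hsk _ (right_mem_Icc.2 (h.t_lt k hk).le)
    rw [interp_right h.t_lt Pk hk] at e1
    have e2 := mul_nonneg (sub_nonneg.2 hsk.2) (sub_nonneg.2 (hVk k hk))
    linarith [hPkle (k + 1) hk]
  have hPk0 : ∀ n ≤ N, 0 ≤ Pk n := fun n hn => Finset.sum_nonneg fun k hk => by
    have hk' : k < N := by have := Finset.mem_range.1 hk; omega
    have := mul_nonneg (hd0 k hk').le (sub_nonneg.2 (hVk k hk'))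
    linarith
  have hright : ∀ s ∈ Ico 0 T, ∃ k < N, s ∈ Icc (t k) (t (k + 1)) ∧
      ∀ᶠ u in 𝓝[>] s, s < u ∧ u ∈ Icc (t k) (t (k + 1)) := by
    intro s hs
    obtain ⟨k, hk, h1, h2⟩ := exists_cell (t := t) (h.t_zero.trans_le hs.1)
      (hs.2.trans_eq h.t_last.symm)
    exact ⟨k, hk, ⟨h1, h2.le⟩, eventually_right_mem_Icc ⟨h1, h2⟩⟩
  have hτc : 2 * (V T - V 0) * τ ≤ c * τ :=
    mul_le_mul_of_nonneg_right (by simp only [hc]; linarith) hτ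
  have hball : ∀ s ∈ Icc 0 T, ‖interp t N y s‖ ≤ r := by
    intro s hs
    obtain ⟨k, hk, hsk⟩ := hcell s hs
    rw [interp_of_mem h.t_lt y hk hsk]
    obtain ⟨θ0, θ1⟩ := hθ k hk s hsk
    have := (convex_closedBall (0 : Z) r).add_smul_sub_mem
      (mem_closedBall_zero_iff.2 (h.norm_le hr hk.le))
      (mem_closedBall_zero_iff.2 (h.norm_le hr hk)) ⟨θ0, θ1⟩
    exact mem_closedBall_zero_iff.1 this
  -- The force is interpolated too, which keeps it stable by convexity. Then `p` is the
  -- interpolation error of the load, with variation `O(τ)`, and `q` that of `D` along the curve, of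
  -- size `O(τ²)`.
  refine ⟨interp t N σ, fun s => interp t N (L ∘ t) s - L s,
    fun s => D (interp t N y s) - interp t N (D ∘ y) s, interp t N Pk, interp t N Bk, ?_⟩
  refine
    { init := ?_
      cont := (continuous_interp t N y).continuousOn
      cont_p := (continuous_interp t N _).continuousOn.sub hLc
      cont_P := (continuous_interp t N _).continuousOn
      cont_B := (continuous_interp t N _).continuousOn
      ball := hball
      stable := ?_
      force := ?_
      p_le := ?_
      q_le := ?_
      P_zero := ?_
      P_le := fun s hs => (hPle s hs).trans hτc
      B_zero := ?_
      B_le := ?_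
      right_lip := ?_
      right_p := ?_
      right_B := ?_
      right_power := ?_ }
  · rw [← h.t_zero, interp_left h.t_lt y h0N, h.init]
  · intro s hs w
    obtain ⟨k, hk, hsk⟩ := hcell s hs
    obtain ⟨θ0, θ1⟩ := hθ k hk s hsk
    rw [interp_of_mem h.t_lt σ hk hsk]
    simp only [_root_.add_apply, _root_.smul_apply, _root_.sub_apply (σ (k + 1)), smul_eq_mul]
    have e1 : σ k w ≤ R w := h.stable k hk.le w
    have e2 : σ (k + 1) w ≤ R w := h.stable (k + 1) hk w
    nlinarith
  · intro s _
    have : interp t N σ s = interp t N (L ∘ t) s - interp t N (D ∘ y) s :=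
      interp_sub t N (L ∘ t) (D ∘ y) s
    rw [this]
    abel
  · intro s hs
    obtain ⟨k, hk, hsk⟩ := hcell s hs
    have hl := left_mem_Icc.2 (h.t_lt k hk).le
    have e1 := hpinc k hk _ hl s hsk hsk.1
    have e2 : interp t N (L ∘ t) (t k) = L (t k) := interp_left h.t_lt (L ∘ t) hk
    rw [e2, sub_self, sub_zero, interp_left h.t_lt Pk hk] at e1
    linarith [hPle s hs, hPk0 k hk.le]
  · intro s hs
    obtain ⟨k, hk, hsk⟩ := hcell s hs
    obtain ⟨θ0, θ1⟩ := hθ k hk s hsk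
    have hb := hball s hs
    rw [interp_of_mem h.t_lt y hk hsk] at hb
    rw [interp_of_mem h.t_lt y hk hsk, interp_of_mem h.t_lt (D ∘ y) hk hsk]
    set θ := (s - t k) / (t (k + 1) - t k)
    have e1 := hD.taylor hC hb (h.norm_le hr hk.le)
    have e2 := hD.taylor hC (h.norm_le hr hk) (h.norm_le hr hk.le)
    rw [add_sub_cancel_left, map_smul, norm_smul, Real.norm_of_nonneg θ0] at e1
    have hn : ‖y (k + 1) - y k‖ ≤ τ := (h.lip k hk).trans (h.t_step k hk)
    have e3 : D (y k + θ • (y (k + 1) - y k)) - ((D ∘ y) k + θ • ((D ∘ y) (k + 1) - (D ∘ y) k)) =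
        (D (y k + θ • (y (k + 1) - y k)) - D (y k) - θ • H (y k) (y (k + 1) - y k))
        - θ • (D (y (k + 1)) - D (y k) - H (y k) (y (k + 1) - y k)) := by
      simp only [Function.comp_apply, smul_sub]
      abel
    rw [e3]
    refine (norm_sub_le _ _).trans ?_
    rw [norm_smul, Real.norm_of_nonneg θ0]
    have e4 : C * ‖y (k + 1) - y k‖ ^ 2 ≤ C * τ ^ 2 :=
      mul_le_mul_of_nonneg_left (pow_le_pow_left₀ (norm_nonneg _) hn 2) hC
    have e5 : C * (θ * ‖y (k + 1) - y k‖) ^ 2 ≤ C * τ ^ 2 :=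
      mul_le_mul_of_nonneg_left (pow_le_pow_left₀ (by positivity)
        ((mul_le_of_le_one_left (norm_nonneg _) θ1).trans hn) 2) hC
    have e6 := (mul_le_of_le_one_left (norm_nonneg _) θ1).trans (e2.trans e4)
    have e7 : 2 * C * τ ^ 2 ≤ c * τ ^ 2 :=
      mul_le_mul_of_nonneg_right (by simp only [hc]; linarith) (sq_nonneg τ)
    linarith
  · rw [← h.t_zero, interp_left h.t_lt Pk h0N]; simp [hPk, h.t_zero]
  · rw [← h.t_zero, interp_left h.t_lt Bk h0N]; simp [hBk, h.t_zero]
  · intro s hs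
    obtain ⟨k, hk, hsk⟩ := hcell s hs
    have e1 := hBinc k hk s hsk _ (right_mem_Icc.2 (h.t_lt k hk).le)
    rw [interp_right h.t_lt Bk hk] at e1
    have e2 := mul_nonneg (div_nonneg (sub_nonneg.2 hsk.2) (hd0 k hk).le) (hβ0 k hk)
    linarith [hBkle (k + 1) hk]
  · intro s hs
    obtain ⟨k, hk, hsk, hev⟩ := hright s hs
    filter_upwards [hev] with u ⟨hsu, huk⟩
    rw [interp_sub_of_mem h.t_lt y hk huk hsk, norm_smul,
      Real.norm_of_nonneg (div_nonneg (sub_nonneg.2 hsu.le) (hd0 k hk).le)]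
    rw [div_mul_eq_mul_div, div_le_iff₀ (hd0 k hk)]
    exact mul_le_mul_of_nonneg_left (h.lip k hk) (sub_nonneg.2 hsu.le)
  · intro s hs
    obtain ⟨k, hk, hsk, hev⟩ := hright s hs
    filter_upwards [hev] with u ⟨hsu, huk⟩
    exact hpinc k hk s hsk u huk hsu.le
  · intro s hs
    obtain ⟨k, hk, hsk, hev⟩ := hright s hs
    filter_upwards [hev] with u ⟨hsu, huk⟩
    have e1 := hBinc k hk s hsk u huk
    have e2 := mul_nonneg (div_nonneg (sub_nonneg.2 hsu.le) (hd0 k hk).le) (hβ0 k hk)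
    linarith
  · intro s hs ε hε
    obtain ⟨k, hk, hsk, hev⟩ := hright s hs
    filter_upwards [hev] with u ⟨hsu, huk⟩
    rw [hBinc k hk s hsk u huk, interp_sub_of_mem h.t_lt y hk huk hsk,
      interp_of_mem h.t_lt σ hk hsk]
    obtain ⟨θ0, θ1⟩ := hθ k hk s hsk
    set θ := (s - t k) / (t (k + 1) - t k)
    have hlam : 0 < (u - s) / (t (k + 1) - t k) := div_pos (sub_pos.2 hsu) (hd0 k hk)
    set lam := (u - s) / (t (k + 1) - t k)
    rw [hR.homogeneous _ hlam, map_smul, smul_eq_mul, _root_.add_apply, _root_.smul_apply,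
      smul_eq_mul]
    have e1 : R (y (k + 1) - y k) ≤ σ (k + 1) (y (k + 1) - y k) := h.power k hk
    have e2 : β k = σ (k + 1) (y (k + 1) - y k) - σ k (y (k + 1) - y k) := by
      simp only [hβ, _root_.sub_apply]
    have e3 : (σ (k + 1) - σ k) (y (k + 1) - y k) = β k := rfl
    rw [e3]
    -- The exact defect is `(1 - θ) β k`; it is enlarged to `β k` so that `B` can be affine on the
    -- cell.
    have e4 : R (y (k + 1) - y k) ≤ σ k (y (k + 1) - y k) + θ * β k + β k := by
      have := mul_nonneg θ0 (hβ0 k hk)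
      linarith
    have e5 := mul_le_mul_of_nonneg_left e4 hlam.le
    have e6 : 0 ≤ ε * (u - s) := mul_nonneg hε.le (sub_nonneg.2 hsu.le)
    linarith

end Incremental

/-! ### Loads whose derivative has bounded variation -/

section Load

theorem IsSobolevDeriv.norm_taylor_le {E : Type*} [NormedAddCommGroup E] [NormedSpace ℝ E]
    [CompleteSpace E] {T : ℝ} (hT : 0 ≤ T) {u g : ℝ → E} (h : IsSobolevDeriv 1 T u g) {s t M : ℝ}
    (hs : s ∈ Icc 0 T) (ht : t ∈ Icc 0 T) (hst : s ≤ t) (c : E)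
    (hM : ∀ x ∈ Icc s t, ‖g x - c‖ ≤ M) : ‖u t - u s - (t - s) • c‖ ≤ (t - s) * M := by
  have e : u t - u s - (t - s) • c = ∫ x in s..t, (g x - c) := by
    rw [intervalIntegral.integral_sub (h.intervalIntegrable hs ht) (by simp), h.sub_eq hT hs ht,
      intervalIntegral.integral_const]
  rw [e]
  have := intervalIntegral.norm_integral_le_of_norm_le_const (f := fun x => g x - c) (a := s)
    (b := t) (C := M) fun x hx => hM x ?_
  · rwa [abs_of_nonneg (sub_nonneg.2 hst), mul_comm] at this
  · rw [uIoc_of_le hst] at hx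
    exact Ioc_subset_Icc_self hx

variable {Z V : Type*} [NormedAddCommGroup Z] [InnerProductSpace ℝ Z]
  [NormedAddCommGroup V] [InnerProductSpace ℝ V]

theorem norm_comp_embedding_le {ι : Z →L[ℝ] V} (hι : ∀ z, ‖ι z‖ ≤ ‖z‖) (f : StrongDual ℝ V) :
    ‖f.comp ι‖ ≤ ‖f‖ :=
  ContinuousLinearMap.opNorm_le_bound _ (norm_nonneg _) fun z =>
    (f.le_opNorm _).trans (mul_le_mul_of_nonneg_left (hι z) (norm_nonneg _))

/-- The control function is the variation of the derivative from time zero: it bounds the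
oscillation of the derivative on `[a, b]`, hence the affine approximation error. Restriction to `Z`
does not increase norms. -/
theorem exists_isLoad {ι : Z →L[ℝ] V} (hι : ∀ z, ‖ι z‖ ≤ ‖z‖) {T : ℝ} (hT : 0 ≤ T)
    {ℓ : ℝ → StrongDual ℝ V} {κ : ℝ} (hLip : ∀ s ∈ Icc 0 T, ∀ t ∈ Icc 0 T,
      ‖ℓ s - ℓ t‖ ≤ κ * |s - t|) (hBV : IsLoadBV T ℓ) :
    ∃ (m : ℝ → StrongDual ℝ Z) (W : ℝ → ℝ), IsLoad T κ (fun t => (ℓ t).comp ι) m W := by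
  obtain ⟨m, hm, hmv⟩ := hBV
  have hm1 : IsSobolevDeriv 1 T ℓ m := ⟨hm.memLp.mono_exponent (by simp), hm.eq_primitive⟩
  have hloc := hmv.locallyBoundedVariationOn
  refine ⟨fun t => (m t).comp ι, variationOnFromTo m (Icc 0 T) 0, ?_, ?_, ?_⟩
  · intro s hs t ht
    rw [← ContinuousLinearMap.sub_comp]
    exact (norm_comp_embedding_le hι _).trans (hLip s hs t ht)
  · exact variationOnFromTo.monotoneOn hloc (left_mem_Icc.2 hT)
  · intro a b c s t ha hb has hst htb hc
    have hI : ∀ x ∈ Icc a b, x ∈ Icc 0 T := fun x hx => ⟨ha.trans hx.1, hx.2.trans hb⟩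
    have hab : a ≤ b := has.trans (hst.trans htb)
    have h0 : (0 : ℝ) ∈ Icc 0 T := left_mem_Icc.2 hT
    have haI := hI a (left_mem_Icc.2 hab)
    have hbI := hI b (right_mem_Icc.2 hab)
    have hvar : ∀ x ∈ Icc a b, ‖m x - m c‖ ≤
        variationOnFromTo m (Icc 0 T) 0 b - variationOnFromTo m (Icc 0 T) 0 a := by
      intro x hx
      rw [← variationOnFromTo.add hloc h0 haI hbI, add_sub_cancel_left,
        variationOnFromTo.eq_of_le _ _ hab, ← dist_eq_norm]
      exact (hmv.mono inter_subset_left).dist_le ⟨hI x hx, hx⟩ ⟨hI c hc, hc⟩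
    have key := hm1.norm_taylor_le hT (hI s ⟨has, hst.trans htb⟩) (hI t ⟨has.trans hst, htb⟩) hst
      (m c) fun x hx => hvar x ⟨has.trans hx.1, hx.2.trans htb⟩
    refine le_trans (le_of_eq_of_le ?_ (norm_comp_embedding_le hι (ℓ t - ℓ s - (t - s) • m c))) key
    congr 1

end Load

/-! ### The differential inclusion as stability plus power balance -/

section Dissipation

variable {Z V X : Type*} [NormedAddCommGroup Z] [InnerProductSpace ℝ Z]
  [NormedAddCommGroup V] [InnerProductSpace ℝ V] [NormedAddCommGroup X] [NormedSpace ℝ X]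

theorem IsDissipation.exists_isSublinear {j : V →L[ℝ] X} {R : V → ℝ} (hR : IsDissipation j R) :
    ∃ ρ, 0 < ρ ∧ IsSublinear ρ R := by
  obtain ⟨ρ₁, ρ₂, h1, h2, h⟩ := hR.bounded
  refine ⟨ρ₂, h2, hR.nonneg, hR.homogeneous, fun u v => ?_, fun v => (h v).2⟩
  have h3 := hR.convex.2 (mem_univ u) (mem_univ v) (by norm_num : (0 : ℝ) ≤ 1 / 2)
    (by norm_num : (0 : ℝ) ≤ 1 / 2) (by norm_num)
  rw [← smul_add, hR.homogeneous _ (by norm_num), smul_eq_mul, smul_eq_mul] at h3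
  linarith

theorem IsSublinear.comp_embedding {ι : Z →L[ℝ] V} (hι : ∀ z, ‖ι z‖ ≤ ‖z‖) {ρ : ℝ} (hρ : 0 ≤ ρ)
    {R : V → ℝ} (hR : IsSublinear ρ R) : IsSublinear ρ fun z => R (ι z) where
  nonneg v := hR.nonneg _
  homogeneous c hc v := by rw [map_smul, hR.homogeneous c hc]
  subadditive u v := by rw [map_add]; exact hR.subadditive _ _
  growth v := (hR.growth _).trans (mul_le_mul_of_nonneg_left (hι v) hρ)

/-- Forwards, the subgradient inequality is tested at `v + w` and at zero. Backwards, the derivative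
gives a functional on the image of `Z` dominated by `R`; Hahn–Banach extends it to `V`, and linear
growth of `R` makes it continuous. -/
theorem inclusion_iff {ι : Z →L[ℝ] V} (hι : Function.Injective ι) {ρ : ℝ} {R : V → ℝ}
    (hR : IsSublinear ρ R) {I : Z → ℝ} {v z : Z} :
    Inclusion ι R I v z ↔
      (∀ w, (-fderiv ℝ I z) w ≤ R (ι w)) ∧ R (ι v) ≤ (-fderiv ℝ I z) v := by
  set g := fderiv ℝ I z
  constructor
  · rintro ⟨ξ, hξ, h⟩
    have e : -g = ξ.comp ι := (eq_neg_of_add_eq_zero_left h).symm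
    rw [e]
    refine ⟨fun w => ?_, ?_⟩
    · have h1 := hξ (ι v + ι w)
      rw [add_sub_cancel_left] at h1
      have h2 := hR.subadditive (ι v) (ι w)
      rw [ContinuousLinearMap.comp_apply]
      linarith
    · have h1 := hξ 0
      rw [hR.map_zero, zero_sub, map_neg] at h1
      rw [ContinuousLinearMap.comp_apply]
      linarith
  · rintro ⟨h1, h2⟩
    let e := LinearEquiv.ofInjective (ι : Z →ₗ[ℝ] V) hι
    let l : V →ₗ.[ℝ] ℝ := ⟨LinearMap.range (ι : Z →ₗ[ℝ] V),
      ((-g : StrongDual ℝ Z) : Z →ₗ[ℝ] ℝ).comp e.symm.toLinearMap⟩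
    have hl : ∀ w : Z, ∃ x : l.domain, (x : V) = ι w ∧ l x = (-g) w := fun w =>
      ⟨e w, rfl, congrArg (-g) (e.symm_apply_apply w)⟩
    have hle : ∀ x : l.domain, l x ≤ R x := by
      intro x
      obtain ⟨w, hw⟩ : ∃ w, ι w = x := x.2
      obtain ⟨x', hx1, hx2⟩ := hl w
      obtain rfl : x' = x := Subtype.ext (hx1.trans hw)
      rw [hx2, hx1]
      exact h1 w
    obtain ⟨f, hf1, hf2⟩ := exists_extension_of_le_sublinear l R hR.homogeneous hR.subadditive hle
    have hfι : ∀ w, f (ι w) = (-g) w := fun w => by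
      obtain ⟨x, hx1, hx2⟩ := hl w
      rw [← hx1, hf1, hx2]
    refine ⟨f.mkContinuous ρ (hR.norm_le f hf2), fun w => ?_, ?_⟩
    · rw [LinearMap.mkContinuous_apply, map_sub, hfι]
      linarith [hf2 w]
    · ext w
      rw [_root_.add_apply, ContinuousLinearMap.comp_apply, LinearMap.mkContinuous_apply, hfι]
      simp [g]

end Dissipation

/-! ### Derivatives of the semilinear energy -/

section Energy

variable {Z V : Type*} [NormedAddCommGroup Z] [InnerProductSpace ℝ Z]
  [NormedAddCommGroup V] [InnerProductSpace ℝ V]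

/-- The derivative of the time-independent part `½⟨Az,z⟩ + F(z)` of the energy. -/
noncomputable def energyDeriv (A : Z →L[ℝ] StrongDual ℝ Z) (F : Z → ℝ) (z : Z) : StrongDual ℝ Z :=
  A z + fderiv ℝ F z

/-- The Hessian of the energy. -/
noncomputable def energyHessian (A : Z →L[ℝ] StrongDual ℝ Z) (F : Z → ℝ) (z : Z) :
    Z →L[ℝ] StrongDual ℝ Z :=
  A + fderiv ℝ (fderiv ℝ F) z

variable {ι : Z →L[ℝ] V} {A : Z →L[ℝ] StrongDual ℝ Z} {F : Z → ℝ} {ℓ : ℝ → StrongDual ℝ V}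

theorem hasFDerivAt_energy (hA : ∀ x y, A x y = A y x) (hF : ContDiff ℝ 2 F) (t : ℝ) (z : Z) :
    HasFDerivAt (energy ι A F ℓ t) (energyDeriv A F z - (ℓ t).comp ι) z := by
  have h1 : HasFDerivAt (fun z => A z z) ((A z).comp (ContinuousLinearMap.id ℝ Z)
      + A.flip z) z := A.hasFDerivAt.clm_apply (hasFDerivAt_id z)
  have h2 := (hF.differentiable (by norm_num) z).hasFDerivAt
  have h3 := ((h1.const_mul (1 / 2)).add h2).sub ((ℓ t).comp ι).hasFDerivAt
  refine h3.congr_fderiv ?_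
  ext w
  simp [energyDeriv, hA w z]
  ring

theorem fderiv_energy (hA : ∀ x y, A x y = A y x) (hF : ContDiff ℝ 2 F) (t : ℝ) :
    fderiv ℝ (energy ι A F ℓ t) = fun z => energyDeriv A F z - (ℓ t).comp ι :=
  funext fun z => (hasFDerivAt_energy hA hF t z).fderiv

theorem hasFDerivAt_energyDeriv (hF : ContDiff ℝ 2 F) (z : Z) :
    HasFDerivAt (energyDeriv A F) (energyHessian A F z) z := by
  have h1 : ContDiff ℝ 1 (fderiv ℝ F) := hF.fderiv_right (by norm_num)
  exact A.hasFDerivAt.add (h1.differentiable (by norm_num) z).hasFDerivAt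

theorem fderiv_fderiv_energy (hA : ∀ x y, A x y = A y x) (hF : ContDiff ℝ 2 F) (t : ℝ) (z : Z) :
    fderiv ℝ (fderiv ℝ (energy ι A F ℓ t)) z = energyHessian A F z := by
  rw [fderiv_energy hA hF]
  exact ((hasFDerivAt_energyDeriv hF z).sub_const _).fderiv

theorem energyHessian_sub (x y : Z) : energyHessian A F x - energyHessian A F y
    = fderiv ℝ (fderiv ℝ F) x - fderiv ℝ (fderiv ℝ F) y := by
  ext u v
  simp only [energyHessian, _root_.sub_apply, _root_.add_apply]
  ring

theorem energyHessian_symm (hA : ∀ x y, A x y = A y x) (hF : ContDiff ℝ 2 F) (z u v : Z) :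
    energyHessian A F z u v = energyHessian A F z v u := by
  have h : IsSymmSndFDerivAt ℝ F z :=
    hF.contDiffAt.isSymmSndFDerivAt (by simp [minSmoothness_of_isRCLikeNormedField])
  simp only [energyHessian, _root_.add_apply]
  rw [hA u v, h.eq u v]

/-- A symmetric bilinear form is bounded by its quadratic form. -/
theorem norm_le_of_quadratic_le {B : Z →L[ℝ] StrongDual ℝ Z} (hB : ∀ u v, B u v = B v u) {c : ℝ}
    (hc : 0 ≤ c) (h : ∀ v, |B v v| ≤ c * ‖v‖ ^ 2) : ‖B‖ ≤ c := by
  have h1 : ∀ u v : Z, ‖u‖ = 1 → ‖v‖ = 1 → |B u v| ≤ c := by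
    intro u v hu hv
    have e : 4 * B u v = B (u + v) (u + v) - B (u - v) (u - v) := by
      simp only [map_add, map_sub, _root_.add_apply, _root_.sub_apply, hB v u]
      ring
    have p := parallelogram_law_with_norm ℝ u v
    have a1 := abs_le.1 (h (u + v))
    have a2 := abs_le.1 (h (u - v))
    rw [hu, hv] at p
    have p' : ‖u + v‖ ^ 2 + ‖u - v‖ ^ 2 = 4 := by linarith
    have p'' : c * ‖u + v‖ ^ 2 + c * ‖u - v‖ ^ 2 = c * 4 := by rw [← mul_add, p']
    rw [abs_le]
    constructor <;> linarith [a1.1, a1.2, a2.1, a2.2]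
  refine ContinuousLinearMap.opNorm_le_bound₂ _ hc fun u v => ?_
  rcases eq_or_ne u 0 with rfl | hu
  · simp
  rcases eq_or_ne v 0 with rfl | hv
  · simp
  have hu' := norm_pos_iff.2 hu
  have hv' := norm_pos_iff.2 hv
  have h2 := h1 (‖u‖⁻¹ • u) (‖v‖⁻¹ • v)
    (by rw [norm_smul, norm_inv, norm_norm, inv_mul_cancel₀ hu'.ne'])
    (by rw [norm_smul, norm_inv, norm_norm, inv_mul_cancel₀ hv'.ne'])
  simp only [map_smul, _root_.smul_apply, smul_eq_mul, abs_mul, abs_inv, abs_norm] at h2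
  rw [Real.norm_eq_abs]
  rw [inv_mul_le_iff₀ hv', inv_mul_le_iff₀ hu'] at h2
  linarith

/-- Exchanging the two points makes the one-sided quadratic bound two-sided, and polarization makes
it an operator bound. The quadratic part cancels in the difference, so the conclusion concerns `F`
alone. -/
theorem exists_lipschitz_hessian (hA : ∀ x y, A x y = A y x) (hF : ContDiff ℝ 2 F) {t r : ℝ}
    (hr : 0 ≤ r) (h : IsC21loc (energy ι A F ℓ t)) : ∃ C, 0 ≤ C ∧ ∀ x y : Z, ‖x‖ ≤ r → ‖y‖ ≤ r →
      ‖fderiv ℝ (fderiv ℝ F) x - fderiv ℝ (fderiv ℝ F) y‖ ≤ C * ‖x - y‖ := by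
  obtain ⟨C, hC, h⟩ := h (r + 1) (by linarith)
  refine ⟨C, hC, fun x y hx hy => ?_⟩
  rw [← energyHessian_sub (A := A)]
  have hmem : ∀ z : Z, ‖z‖ ≤ r → z ∈ Metric.ball (0 : Z) (r + 1) := fun z hz =>
    mem_ball_zero_iff.2 (by linarith)
  simp only [fderiv_fderiv_energy hA hF] at h
  refine norm_le_of_quadratic_le (fun u v => ?_) (by positivity) fun v => ?_
  · simp only [_root_.sub_apply, energyHessian_symm hA hF _ u v]
  · have h1 := h x (hmem x hx) y (hmem y hy) v
    have h2 := h y (hmem y hy) x (hmem x hx) v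
    rw [norm_sub_rev] at h2
    simp only [_root_.sub_apply] at h1 h2 ⊢
    rw [abs_le]
    constructor <;> linarith

theorem isEnergyDeriv (hA : ∀ x y, A x y = A y x) (hF : ContDiff ℝ 2 F) {t r C κ : ℝ}
    (hr : 0 ≤ r) (hC : 0 ≤ C) (hCF : ∀ x y : Z, ‖x‖ ≤ r → ‖y‖ ≤ r →
      ‖fderiv ℝ (fderiv ℝ F) x - fderiv ℝ (fderiv ℝ F) y‖ ≤ C * ‖x - y‖)
    (hconv : IsUniformlyConvex κ (energy ι A F ℓ t)) :
    IsEnergyDeriv r (‖A‖ + ‖fderiv ℝ (fderiv ℝ F) 0‖ + C * r) C κ (energyDeriv A F)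
      (energyHessian A F) where
  hasFDerivAt := hasFDerivAt_energyDeriv hF
  symm := energyHessian_symm hA hF
  coercive x v := by
    have := hconv x v
    rwa [fderiv_fderiv_energy hA hF] at this
  bound x hx := by
    have h1 := hCF x 0 hx (by simpa using hr)
    rw [sub_zero] at h1
    have h2 := norm_le_norm_add_norm_sub' (fderiv ℝ (fderiv ℝ F) x) (fderiv ℝ (fderiv ℝ F) 0)
    have h3 := norm_add_le A (fderiv ℝ (fderiv ℝ F) x)
    have h4 := mul_le_mul_of_nonneg_left hx hC
    simp only [energyHessian]
    linarith
  lipschitz x y hx hy := by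
    rw [energyHessian_sub]
    exact hCF x y hx hy

end Energy

/-! ### Existence and optimality conditions for one constrained step -/

section Minimization

variable {Z : Type*} [NormedAddCommGroup Z] [InnerProductSpace ℝ Z]

theorem first_order_le {I : Z → ℝ} {g : Z → StrongDual ℝ Z} {κ : ℝ}
    (hI : ∀ z, HasFDerivAt I (g z) z)
    (hg : ∀ x y, κ * ‖x - y‖ ^ 2 ≤ (g x - g y) (x - y)) (x y : Z) :
    I y + g y (x - y) + κ / 2 * ‖x - y‖ ^ 2 ≤ I x := by
  set w := x - y with hw
  have hder : ∀ s : ℝ, HasDerivAt (fun s : ℝ => I (y + s • w) - s * g y w - κ / 2 * (s * s) * ‖w‖ ^ 2)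
      (g (y + s • w) w - g y w - κ * s * ‖w‖ ^ 2) s := by
    intro s
    have h1 : HasDerivAt (fun s : ℝ => y + s • w) w s := by
      simpa using ((hasDerivAt_id s).smul_const w).const_add y
    have h2 := (hI (y + s • w)).comp_hasDerivAt s h1
    have h3 := (h2.sub ((hasDerivAt_id s).mul_const (g y w))).sub
      ((((hasDerivAt_id s).mul (hasDerivAt_id s)).const_mul (κ / 2)).mul_const (‖w‖ ^ 2))
    refine (h3.congr_deriv ?_).congr_of_eventuallyEq (Eventually.of_forall fun s => ?_)
    · simp only [id_eq]; ring
    · simp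
  have hmono : MonotoneOn
      (fun s : ℝ => I (y + s • w) - s * g y w - κ / 2 * (s * s) * ‖w‖ ^ 2) (Icc 0 1) := by
    apply monotoneOn_of_deriv_nonneg (convex_Icc 0 1)
      (fun s _ => (hder s).continuousAt.continuousWithinAt)
      (fun s _ => (hder s).differentiableAt.differentiableWithinAt)
    intro s hs
    rw [interior_Icc] at hs
    rw [(hder s).deriv]
    have h1 := hg (y + s • w) y
    rw [add_sub_cancel_left, map_smul, norm_smul, Real.norm_of_nonneg hs.1.le, smul_eq_mul,
      _root_.sub_apply] at h1
    have h2 : s * (κ * s * ‖w‖ ^ 2) ≤ s * (g (y + s • w) w - g y w) := by nlinarith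
    linarith [le_of_mul_le_mul_left h2 hs.1]
  have := hmono (left_mem_Icc.2 zero_le_one) (right_mem_Icc.2 zero_le_one) zero_le_one
  simp only [zero_smul, add_zero, one_smul, zero_mul, sub_zero, one_mul, mul_one,
    mul_zero] at this
  have e : y + w = x := by rw [hw]; abel
  rw [e] at this
  linarith

/-- Uniform midpoint convexity makes minimizing sequences Cauchy, so completeness replaces
compactness. -/
theorem exists_minimizer_of_midpoint [CompleteSpace Z] {Φ : Z → ℝ} {S : Set Z} {κ : ℝ}
    (hκ : 0 < κ) (hS : IsClosed S) (hSc : Convex ℝ S) (hne : S.Nonempty) (hΦ : Continuous Φ)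
    {b : ℝ} (hb : ∀ x, b ≤ Φ x)
    (hmid : ∀ x y, Φ ((1 / 2 : ℝ) • x + (1 / 2 : ℝ) • y) + κ * ‖x - y‖ ^ 2 ≤ (Φ x + Φ y) / 2) :
    ∃ x ∈ S, ∀ y ∈ S, Φ x ≤ Φ y := by
  have hbdd : BddBelow (Φ '' S) := ⟨b, by rintro _ ⟨x, -, rfl⟩; exact hb x⟩
  set i := sInf (Φ '' S) with hi
  have hile : ∀ x ∈ S, i ≤ Φ x := fun x hx => csInf_le hbdd ⟨x, hx, rfl⟩
  have hex : ∀ n : ℕ, ∃ x ∈ S, Φ x < i + 1 / ((n : ℝ) + 1) := by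
    intro n
    obtain ⟨_, ⟨x, hx, rfl⟩, h⟩ := exists_lt_of_csInf_lt (hne.image Φ)
      (show sInf (Φ '' S) < i + 1 / ((n : ℝ) + 1) by
        have : (0 : ℝ) < 1 / ((n : ℝ) + 1) := by positivity
        linarith)
    exact ⟨x, hx, h⟩
  choose x hxS hx using hex
  have hdist : ∀ n m : ℕ, κ * ‖x n - x m‖ ^ 2 ≤ (1 / ((n : ℝ) + 1) + 1 / ((m : ℝ) + 1)) / 2 := by
    intro n m
    have h1 := hmid (x n) (x m)
    have h2 := hile _ (hSc (hxS n) (hxS m) (by norm_num : (0 : ℝ) ≤ 1 / 2)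
      (by norm_num : (0 : ℝ) ≤ 1 / 2) (by norm_num))
    linarith [hx n, hx m]
  have hlim : Tendsto (fun n : ℕ => 1 / ((n : ℝ) + 1)) atTop (𝓝 0) :=
    tendsto_one_div_add_atTop_nhds_zero_nat
  have hcs : CauchySeq x := by
    rw [Metric.cauchySeq_iff]
    intro ε hε
    obtain ⟨N, hN⟩ := eventually_atTop.1
      (hlim.eventually (gt_mem_nhds (by positivity : 0 < κ * ε ^ 2)))
    refine ⟨N, fun m hm n hn => ?_⟩
    rw [dist_eq_norm]
    have h1 := hdist m n
    have h2 : κ * ‖x m - x n‖ ^ 2 < κ * ε ^ 2 := by linarith [hN m hm, hN n hn]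
    exact lt_of_pow_lt_pow_left₀ 2 hε.le (lt_of_mul_lt_mul_left h2 hκ.le)
  obtain ⟨a, ha⟩ := cauchySeq_tendsto_of_complete hcs
  refine ⟨a, hS.mem_of_tendsto ha (Eventually.of_forall hxS), fun y hy => ?_⟩
  have h1 : Tendsto (fun n : ℕ => i + 1 / ((n : ℝ) + 1)) atTop (𝓝 (i + 0)) := hlim.const_add i
  have h2 := le_of_tendsto_of_tendsto ((hΦ.tendsto a).comp ha) h1
    (Eventually.of_forall fun n => (hx n).le)
  rw [add_zero] at h2
  exact h2.trans (hile y hy)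

variable {V : Type*} [NormedAddCommGroup V] [InnerProductSpace ℝ V]

/-- Solvability of one step of the local incremental minimization scheme. -/
theorem exists_local_minimizer [CompleteSpace Z] {ι : Z →L[ℝ] V} {I : Z → ℝ}
    {g : Z → StrongDual ℝ Z} {κ ρ τ : ℝ} (hκ : 0 < κ) (hτ : 0 ≤ τ)
    (hI : ∀ z, HasFDerivAt I (g z) z)
    (hg : ∀ x y, κ * ‖x - y‖ ^ 2 ≤ (g x - g y) (x - y)) {R : Z → ℝ} (hR : IsSublinear ρ R) (x : Z) :
    ∃ x', ‖ι (x' - x)‖ ≤ τ ∧ ∀ w, ‖ι (w - x)‖ ≤ τ → I x' + R (x' - x) ≤ I w + R (w - x) := by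
  have hIc : Continuous I := continuous_iff_continuousAt.2 fun z => (hI z).continuousAt
  -- Each endpoint lies at distance `‖a - b‖/2` from the midpoint, which turns `κ/2` into `κ/8`. The
  -- lower bound is Young's inequality applied to the linear term at zero.
  refine exists_minimizer_of_midpoint (S := {w | ‖ι (w - x)‖ ≤ τ})
    (Φ := fun w => I w + R (w - x)) (κ := κ / 8) (b := I 0 - ‖g 0‖ ^ 2 / (2 * κ)) (by positivity)
    ?_ ?_ ⟨x, by simpa using hτ⟩ ?_ ?_ ?_
  · exact isClosed_le (by fun_prop) continuous_const
  · intro a ha b hb s t hs ht hst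
    have e : ι (s • a + t • b - x) = s • ι (a - x) + t • ι (b - x) := by
      have : s • a + t • b - x = s • (a - x) + t • (b - x) := by
        have : s = 1 - t := by linarith
        subst this; module
      rw [this, map_add, map_smul, map_smul]
    exact mem_closedBall_zero_iff.1 (e ▸ (convex_closedBall (0 : V) τ)
      (mem_closedBall_zero_iff.2 ha) (mem_closedBall_zero_iff.2 hb) hs ht hst)
  · exact hIc.add (hR.continuous.comp (continuous_id.sub continuous_const))
  · intro w
    have h1 := first_order_le hI hg w 0
    have h2 := dual_apply_le (-g 0) (w - 0)
    rw [norm_neg, _root_.neg_apply] at h2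
    have h3 : ‖g 0‖ * ‖w - 0‖ ≤ ‖g 0‖ ^ 2 / (2 * κ) + κ / 2 * ‖w - 0‖ ^ 2 := by
      have : ‖g 0‖ ^ 2 / (2 * κ) + κ / 2 * ‖w - 0‖ ^ 2 - ‖g 0‖ * ‖w - 0‖
          = (‖g 0‖ - κ * ‖w - 0‖) ^ 2 / (2 * κ) := by field_simp; ring
      have h4 : 0 ≤ (‖g 0‖ - κ * ‖w - 0‖) ^ 2 / (2 * κ) := by positivity
      linarith
    linarith [hR.nonneg (w - x)]
  · intro a b
    set c := (1 / 2 : ℝ) • a + (1 / 2 : ℝ) • b with hc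
    have h1 := first_order_le hI hg a c
    have h2 := first_order_le hI hg b c
    have e1 : a - c = (1 / 2 : ℝ) • (a - b) := by rw [hc]; module
    have e2 : b - c = -((1 / 2 : ℝ) • (a - b)) := by rw [hc]; module
    rw [e1, norm_smul] at h1
    rw [e2, map_neg, norm_neg, norm_smul] at h2
    have e3 : c - x = (1 / 2 : ℝ) • ((a - x) + (b - x)) := by rw [hc]; module
    have h3 := hR.subadditive (a - x) (b - x)
    have h4 : R (c - x) = 1 / 2 * R ((a - x) + (b - x)) := by
      rw [e3, hR.homogeneous _ (by norm_num)]
    norm_num at h1 h2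
    rw [h4]
    linarith

theorem tendsto_diff_quotient {I : Z → ℝ} {g : StrongDual ℝ Z} {x : Z} (hI : HasFDerivAt I g x)
    (u : Z) : Tendsto (fun s : ℝ => (I (x + s • u) - I x) / s) (𝓝[>] 0) (𝓝 (g u)) := by
  have h1 : HasDerivAt (fun s : ℝ => x + s • u) u 0 := by
    simpa using ((hasDerivAt_id (0 : ℝ)).smul_const u).const_add x
  have hI' : HasFDerivAt I g (x + (0 : ℝ) • u) := by simpa using hI
  have h2 := hI'.comp_hasDerivAt (0 : ℝ) h1
  have h3 := (hasDerivAt_iff_tendsto_slope_zero.1 h2).mono_left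
    (nhdsWithin_mono 0 (fun s (hs : 0 < s) => ne_of_gt hs) : 𝓝[>] (0 : ℝ) ≤ 𝓝[≠] 0)
  refine h3.congr fun s => ?_
  simp [div_eq_inv_mul]

/-- Shrinking the increment stays admissible even if the constraint is active, and by homogeneity
this variation yields the power inequality. -/
theorem local_minimizer_power {ι : Z →L[ℝ] V} {I : Z → ℝ} {g : StrongDual ℝ Z} {ρ τ : ℝ}
    {R : Z → ℝ} (hR : IsSublinear ρ R) {x x' : Z} (hI : HasFDerivAt I g x')
    (hx' : ‖ι (x' - x)‖ ≤ τ)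
    (hmin : ∀ w, ‖ι (w - x)‖ ≤ τ → I x' + R (x' - x) ≤ I w + R (w - x)) :
    R (x' - x) ≤ (-g) (x' - x) := by
  have h := tendsto_diff_quotient hI (-(x' - x))
  rw [map_neg] at h
  rw [_root_.neg_apply]
  refine ge_of_tendsto h ?_
  filter_upwards [Ioo_mem_nhdsGT (zero_lt_one' ℝ)] with s hs
  have e : x' + s • -(x' - x) - x = (1 - s) • (x' - x) := by module
  have h1 : 0 < 1 - s := sub_pos.2 hs.2
  have h2 := hmin (x' + s • -(x' - x)) (by
    rw [e, map_smul, norm_smul, Real.norm_of_nonneg h1.le]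
    exact (mul_le_of_le_one_left (norm_nonneg _) (by linarith [hs.1])).trans hx')
  rw [e, hR.homogeneous _ h1] at h2
  rw [le_div_iff₀ hs.1]
  linarith

/-- Strict inequality in the constraint leaves room for small variations in every direction. -/
theorem local_minimizer_stable {ι : Z →L[ℝ] V} {I : Z → ℝ} {g : StrongDual ℝ Z} {ρ τ : ℝ}
    {R : Z → ℝ} (hR : IsSublinear ρ R) {x x' : Z} (hI : HasFDerivAt I g x')
    (hx' : ‖ι (x' - x)‖ < τ)
    (hmin : ∀ w, ‖ι (w - x)‖ ≤ τ → I x' + R (x' - x) ≤ I w + R (w - x)) (u : Z) :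
    (-g) u ≤ R u := by
  have h := tendsto_diff_quotient hI u
  rw [_root_.neg_apply, neg_le]
  refine ge_of_tendsto h ?_
  have hev : ∀ᶠ s : ℝ in 𝓝[>] 0, ‖ι (x' + s • u - x)‖ < τ := by
    have hc : Continuous fun s : ℝ => ‖ι (x' + s • u - x)‖ := by fun_prop
    have h1 := (hc.tendsto 0).mono_left (nhdsWithin_le_nhds (s := Ioi 0))
    rw [zero_smul, add_zero] at h1
    exact h1.eventually (gt_mem_nhds hx')
  filter_upwards [hev, self_mem_nhdsWithin] with s hs (hs0 : 0 < s)
  have h1 := hmin _ hs.le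
  have h2 := hR.subadditive (x' - x) (s • u)
  rw [hR.homogeneous _ hs0] at h2
  have e : x' + s • u - x = x' - x + s • u := by abel
  rw [e] at h1
  rw [le_div_iff₀ hs0]
  linarith

end Minimization

/-! ### Interpolation in artificial time -/

section Interpolant

variable {E : Type*} [NormedAddCommGroup E] [NormedSpace ℝ E] {τ : ℝ}

theorem affineInterpolant_eq (hτ : 0 < τ) (x : ℕ → E) {k : ℕ} {θ : ℝ} (h0 : 0 ≤ θ) (h1 : θ < 1) :
    affineInterpolant τ x ((k + θ) * τ) = x k + θ • (x (k + 1) - x k) := by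
  have e : ⌊(k + θ) * τ / τ⌋₊ = k := by
    rw [mul_div_cancel_right₀ _ hτ.ne', Nat.floor_eq_iff (by positivity)]
    constructor <;> linarith
  unfold affineInterpolant
  rw [e]
  congr 2
  field_simp
  ring

/-- The right endpoint is the start of cell `N` with `θ = 0`, so values after the final index never
enter. -/
theorem exists_cell_coordinates (hτ : 0 < τ) {N : ℕ} {s : ℝ} (h0 : 0 ≤ s) (hN : s ≤ N * τ) :
    ∃ (k : ℕ) (θ : ℝ), k ≤ N ∧ (k = N → θ = 0) ∧ 0 ≤ θ ∧ θ < 1 ∧ s = (k + θ) * τ := by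
  have h1 : 0 ≤ s / τ := div_nonneg h0 hτ.le
  have h2 : s / τ ≤ N := by rwa [div_le_iff₀ hτ]
  have h3 := Nat.floor_le h1
  have h4 := Nat.lt_floor_add_one (s / τ)
  refine ⟨⌊s / τ⌋₊, s / τ - ⌊s / τ⌋₊, ?_, fun h => ?_, by linarith, by linarith, ?_⟩
  · exact_mod_cast h3.trans h2
  · have : ((⌊s / τ⌋₊ : ℕ) : ℝ) = N := by rw [h]
    linarith
  · rw [add_sub_cancel, div_mul_cancel₀ _ hτ.ne']

theorem strictMonoOn_affineInterpolant (hτ : 0 < τ) {t : ℕ → ℝ} {N : ℕ}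
    (ht : ∀ k < N, t k < t (k + 1)) :
    StrictMonoOn (affineInterpolant τ t) (Icc 0 (N * τ)) := by
  intro a ha b hb hab
  obtain ⟨k, θ, hk, hkN, h0, h1, rfl⟩ := exists_cell_coordinates hτ ha.1 ha.2
  obtain ⟨k', θ', hk', hkN', h0', h1', rfl⟩ := exists_cell_coordinates hτ hb.1 hb.2
  have hlt : (k : ℝ) + θ < k' + θ' := lt_of_mul_lt_mul_right hab hτ.le
  have hkk : k ≤ k' := by
    by_contra! hc
    have : (k' : ℝ) + 1 ≤ k := by exact_mod_cast hc
    linarith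
  rw [affineInterpolant_eq hτ t h0 h1, affineInterpolant_eq hτ t h0' h1', smul_eq_mul, smul_eq_mul]
  rcases hkk.eq_or_lt with rfl | hkk'
  · have h2 : θ < θ' := by linarith
    have hkn : k < N := lt_of_le_of_ne hk fun h => by
      have := hkN' h
      linarith
    have := mul_lt_mul_of_pos_right h2 (sub_pos.2 (ht k hkn))
    linarith
  · have hkn : k < N := hkk'.trans_le hk'
    have e1 := mul_lt_mul_of_pos_right h1 (sub_pos.2 (ht k hkn))
    have e2 : t (k + 1) ≤ t k' := le_of_grid ht hkk' hk'
    have e3 : 0 ≤ θ' * (t (k' + 1) - t k') := by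
      rcases hk'.eq_or_lt with rfl | h
      · rw [hkN' rfl, zero_mul]
      · exact mul_nonneg h0' (sub_pos.2 (ht k' h)).le
    linarith

theorem bijOn_affineInterpolant (hτ : 0 < τ) {t : ℕ → ℝ} {N : ℕ}
    (ht : ∀ k < N, t k < t (k + 1)) :
    BijOn (affineInterpolant τ t) (Icc 0 (N * τ)) (Icc (t 0) (t N)) := by
  refine ⟨fun s hs => ?_, (strictMonoOn_affineInterpolant hτ ht).injOn, fun r hr => ?_⟩
  · obtain ⟨k, θ, hk, hkN, h0, h1, rfl⟩ := exists_cell_coordinates hτ hs.1 hs.2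
    rw [affineInterpolant_eq hτ t h0 h1, smul_eq_mul]
    have e1 : t 0 ≤ t k := le_of_grid ht (Nat.zero_le k) hk
    rcases hk.eq_or_lt with rfl | h
    · rw [hkN rfl, zero_mul, add_zero]
      exact ⟨e1, le_rfl⟩
    · have e2 := sub_pos.2 (ht k h)
      have e3 : t (k + 1) ≤ t N := le_of_grid ht h le_rfl
      have e4 := mul_nonneg h0 e2.le
      have e5 := mul_le_of_le_one_left e2.le h1.le
      exact ⟨by linarith, by linarith⟩
  · rcases hr.2.eq_or_lt with rfl | h
    · refine ⟨(N + 0) * τ, ⟨by positivity, by simp⟩, ?_⟩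
      rw [affineInterpolant_eq hτ t le_rfl zero_lt_one, zero_smul, add_zero]
    · obtain ⟨k, hk, h1, h2⟩ := exists_cell hr.1 h
      have e2 := sub_pos.2 (ht k hk)
      have h0 : 0 ≤ (r - t k) / (t (k + 1) - t k) := div_nonneg (sub_nonneg.2 h1) e2.le
      have h1' : (r - t k) / (t (k + 1) - t k) < 1 := by
        rw [div_lt_one e2]; linarith
      refine ⟨(k + (r - t k) / (t (k + 1) - t k)) * τ, ⟨by positivity, ?_⟩, ?_⟩
      · have : (k : ℝ) + 1 ≤ N := by exact_mod_cast hk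
        exact mul_le_mul_of_nonneg_right (by linarith) hτ.le
      · rw [affineInterpolant_eq hτ t h0 h1', smul_eq_mul, div_mul_cancel₀ _ e2.ne']
        abel

end Interpolant

/-! ### The local incremental minimization scheme -/

section Scheme

variable {Z V : Type*} [NormedAddCommGroup Z] [InnerProductSpace ℝ Z]
  [NormedAddCommGroup V] [InnerProductSpace ℝ V] {ι : Z →L[ℝ] V}
  {r Λ C κ δ ρ T τ : ℝ} {D : Z → StrongDual ℝ Z} {H : Z → Z →L[ℝ] StrongDual ℝ Z}
  {L : ℝ → StrongDual ℝ Z} {R : V → ℝ} {I : ℝ → Z → ℝ} {z₀ : Z} {z : ℕ → Z} {t : ℕ → ℝ}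

theorem exists_isLocalMinScheme [CompleteSpace Z] (hD : IsEnergyDeriv r Λ C κ D H) (hκ : 0 < κ)
    (hI : ∀ t z, HasFDerivAt (I t) (D z - L t) z) (hR : IsSublinear ρ fun z => R (ι z))
    (hτ : 0 ≤ τ) : ∃ (z : ℕ → Z) (t : ℕ → ℝ), IsLocalMinScheme ι R I T z₀ τ z t := by
  have hex : ∀ (t : ℝ) (x : Z), ∃ x', ‖ι (x' - x)‖ ≤ τ ∧ ∀ w, ‖ι (w - x)‖ ≤ τ →
      I t x' + R (ι (x' - x)) ≤ I t w + R (ι (w - x)) := fun t x =>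
    exists_local_minimizer hκ hτ (hI t) (fun x y => by
      rw [sub_sub_sub_cancel_right]; exact hD.monotone x y) hR x
  choose next hnext using hex
  let p : ℕ → Z × ℝ := fun k => Nat.rec (z₀, 0)
    (fun _ p => (next p.2 p.1, min (p.2 + τ - ‖ι (next p.2 p.1 - p.1)‖) T)) k
  exact ⟨fun k => (p k).1, fun k => (p k).2, rfl, rfl, fun k => hnext (p k).2 (p k).1,
    fun k => rfl⟩

/-- Invariants of the local incremental minimization scheme. -/
theorem IsLocalMinScheme.step (hD : IsEnergyDeriv r Λ C κ D H) (hκ : 0 < κ) (hδ : 0 < δ)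
    (hδκ : δ ≤ κ) (hι : ∀ z, ‖ι z‖ ≤ ‖z‖) (hT : 0 ≤ T)
    (hL : ∀ s ∈ Icc 0 T, ∀ t ∈ Icc 0 T, ‖L s - L t‖ ≤ (κ - δ) * |s - t|)
    (hI : ∀ t z, HasFDerivAt (I t) (D z - L t) z) (hR : IsSublinear ρ fun z => R (ι z))
    (hstab : ∀ w, (L 0 - D z₀) w ≤ R (ι w)) (hτ : 0 < τ)
    (h : IsLocalMinScheme ι R I T z₀ τ z t) (k : ℕ) :
    (0 ≤ t (k - 1) ∧ t (k - 1) ≤ t k ∧ t k ≤ T ∧ t k - t (k - 1) ≤ τ ∧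
      ∀ w, (L (t (k - 1)) - D (z k)) w ≤ R (ι w)) ∧
    κ * ‖z (k + 1) - z k‖ ≤ (κ - δ) * (t k - t (k - 1)) := by
  -- Stability of `z k` at `t (k - 1)`, the power inequality for the new increment and monotonicity
  -- of `D` bound the increment by the change of the load.
  have hstep : ∀ k, (0 ≤ t (k - 1) ∧ t (k - 1) ≤ t k ∧ t k ≤ T ∧ t k - t (k - 1) ≤ τ ∧
      ∀ w, (L (t (k - 1)) - D (z k)) w ≤ R (ι w)) →
      κ * ‖z (k + 1) - z k‖ ≤ (κ - δ) * (t k - t (k - 1)) := by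
    rintro k ⟨h0, h1, h2, -, h4⟩
    have hp := local_minimizer_power (R := fun z => R (ι z)) hR (hI (t k) (z (k + 1)))
      (h.mem_argmin k).1 (h.mem_argmin k).2
    have hm := hD.monotone (z (k + 1)) (z k)
    set d := z (k + 1) - z k
    have hl := (dual_apply_le (L (t k) - L (t (k - 1))) d).trans
      (mul_le_mul_of_nonneg_right (hL (t k) ⟨h0.trans h1, h2⟩ (t (k - 1)) ⟨h0, h1.trans h2⟩)
        (norm_nonneg d))
    rw [abs_of_nonneg (sub_nonneg.2 h1)] at hl
    have hs := (h4 d).trans hp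
    simp only [_root_.sub_apply, _root_.neg_apply] at hs hm hl
    rcases (norm_nonneg d).eq_or_lt with hd | hd
    · rw [← hd, mul_zero]
      exact mul_nonneg (sub_nonneg.2 hδκ) (sub_nonneg.2 h1)
    · refine le_of_mul_le_mul_right ?_ hd
      linarith
  have hinv : 0 ≤ t (k - 1) ∧ t (k - 1) ≤ t k ∧ t k ≤ T ∧ t k - t (k - 1) ≤ τ ∧
      ∀ w, (L (t (k - 1)) - D (z k)) w ≤ R (ι w) := by
    induction k with
    | zero =>
      -- For `k = 0` truncated subtraction identifies the previous time with `t 0`, so the invariant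
      -- is just the stability of the initial state.
      simp only [Nat.zero_sub, h.t_zero, h.z_zero]
      exact ⟨le_rfl, le_rfl, hT, by linarith, hstab⟩
    | succ k ih =>
      have hb := hstep k ih
      obtain ⟨h0, h1, h2, h3, -⟩ := ih
      -- The factor `κ - δ < κ` is what makes the constraint inactive.
      have h5 : ‖z (k + 1) - z k‖ < τ := by
        refine lt_of_mul_lt_mul_left (hb.trans_lt ?_) hκ.le
        have := mul_le_mul_of_nonneg_left h3 (sub_nonneg.2 hδκ)
        nlinarith
      have h6 : ‖ι (z (k + 1) - z k)‖ < τ := (hι _).trans_lt h5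
      have ht := h.t_update k
      rw [Nat.add_sub_cancel]
      have h7 : t k ≤ t (k + 1) := by
        rw [ht]; exact le_min (by linarith) h2
      refine ⟨h0.trans h1, h7, ?_, ?_, fun w => ?_⟩
      · rw [ht]; exact min_le_right _ _
      · have : t (k + 1) ≤ t k + τ - ‖ι (z (k + 1) - z k)‖ := by
          rw [ht]; exact min_le_left _ _
        linarith [norm_nonneg (ι (z (k + 1) - z k))]
      · have := local_minimizer_stable (R := fun z => R (ι z)) hR (hI (t k) (z (k + 1))) h6
          (h.mem_argmin k).2 w
        rwa [neg_sub] at this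
  exact ⟨hinv, hstep k hinv⟩

/-- The local incremental minimization scheme reaches the final time, and produces incremental
solutions. -/
theorem IsLocalMinScheme.isIncremental (hD : IsEnergyDeriv r Λ C κ D H) (hκ : 0 < κ)
    (hδ : 0 < δ) (hδκ : δ ≤ κ) (hι : ∀ z, ‖ι z‖ ≤ ‖z‖) (hT : 0 ≤ T)
    (hL : ∀ s ∈ Icc 0 T, ∀ t ∈ Icc 0 T, ‖L s - L t‖ ≤ (κ - δ) * |s - t|)
    (hI : ∀ t z, HasFDerivAt (I t) (D z - L t) z) (hR : IsSublinear ρ fun z => R (ι z))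
    (hstab : ∀ w, (L 0 - D z₀) w ≤ R (ι w)) (hτ : 0 < τ)
    (h : IsLocalMinScheme ι R I T z₀ τ z t) :
    IsIncremental T z₀ L D (fun z => R (ι z)) τ (finalIndex T t) t (fun k => z (k + 1)) := by
  have hs := h.step hD hκ hδ hδκ hι hT hL hI hR hstab hτ
  -- An increment of length at most `(1 - δ/κ)τ` leaves at least `δτ/κ` for the advance of time.
  have hinc : ∀ k, t k < T → min (t k + δ / κ * τ) T ≤ t (k + 1) := by
    intro k _
    obtain ⟨⟨-, -, -, h3, -⟩, hb⟩ := hs k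
    rw [h.t_update k]
    refine min_le_min_right T ?_
    have h4 : κ * ‖z (k + 1) - z k‖ ≤ (κ - δ) * τ :=
      hb.trans (mul_le_mul_of_nonneg_left h3 (sub_nonneg.2 hδκ))
    have h5 : ‖z (k + 1) - z k‖ ≤ τ - δ / κ * τ := by
      refine le_of_mul_le_mul_left (h4.trans_eq ?_) hκ
      field_simp
    linarith [hι (z (k + 1) - z k)]
  have hpos : 0 < δ / κ * τ := by positivity
  have hlow : ∀ k : ℕ, min (k * (δ / κ * τ)) T ≤ t k := by
    intro k
    induction k with
    | zero => rw [h.t_zero]; simp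
    | succ k ih =>
      rcases (hs k).1.2.2.1.eq_or_lt with hk | hk
      · exact (min_le_right _ _).trans (hk.symm.trans_le (by
          have := (hs (k + 1)).1.2.1
          rwa [Nat.add_sub_cancel] at this))
      · refine le_trans ?_ (hinc k hk)
        refine le_min ?_ (min_le_right _ _)
        rcases min_le_iff.1 ih with h1 | h1
        · refine (min_le_left _ _).trans ?_
          push_cast
          linarith
        · exact absurd h1 (not_le.2 hk)
  have hne : {k | t k = T}.Nonempty := by
    obtain ⟨k, hk⟩ := exists_nat_gt (T / (δ / κ * τ))
    rw [div_lt_iff₀ hpos] at hk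
    refine ⟨k, le_antisymm (hs k).1.2.2.1 ?_⟩
    have := hlow k
    rwa [min_eq_right hk.le] at this
  refine
    { t_zero := h.t_zero
      t_last := Nat.sInf_mem hne
      t_lt := fun k hk => ?_
      t_step := fun k _ => ?_
      init := ?_
      lip := fun k _ => ?_
      stable := fun k _ w => ?_
      power := fun k _ => ?_ }
  · have hkT : t k < T := lt_of_le_of_ne (hs k).1.2.2.1 (Nat.notMem_of_lt_sInf hk)
    exact (lt_min (by linarith) hkT).trans_le (hinc k hkT)
  · have := (hs (k + 1)).1.2.2.2.1
    rwa [Nat.add_sub_cancel] at this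
  -- The load has not changed before the first step, so that step does not move and the shifted
  -- sequence also starts at `z₀`.
  · have h1 := (hs 0).2
    simp only [Nat.zero_sub, sub_self, mul_zero, zero_add, h.z_zero] at h1
    have h2 : ‖z 1 - z₀‖ ≤ 0 := by
      by_contra! hc
      nlinarith
    simpa [sub_eq_zero] using h2
  · have h1 := (hs (k + 1)).2
    have h2 := (hs (k + 1)).1.2.1
    rw [Nat.add_sub_cancel] at h1 h2
    refine le_of_mul_le_mul_left (h1.trans ?_) hκ
    exact mul_le_mul_of_nonneg_right (by linarith) (sub_nonneg.2 h2)
  · have := (hs (k + 1)).1.2.2.2.2 w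
    rwa [Nat.add_sub_cancel] at this
  · have := local_minimizer_power (R := fun z => R (ι z)) hR (hI (t (k + 1)) (z (k + 2)))
      (h.mem_argmin (k + 1)).1 (h.mem_argmin (k + 1)).2
    rwa [neg_sub] at this

end Scheme

/-! ### From grid errors to the back-transformed iterates -/

section ErrorEstimate

variable {Z V : Type*} [NormedAddCommGroup Z] [InnerProductSpace ℝ Z]
  [NormedAddCommGroup V] [InnerProductSpace ℝ V] {ι : Z →L[ℝ] V}
  {r Λ C κ δ ρ T τ : ℝ} {D : Z → StrongDual ℝ Z} {H : Z → Z →L[ℝ] StrongDual ℝ Z}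
  {L : ℝ → StrongDual ℝ Z} {R : V → ℝ} {I : ℝ → Z → ℝ} {z₀ : Z} {z : ℕ → Z} {t : ℕ → ℝ}

theorem isDifferentialSolution_iff (hι : Function.Injective ι) (hR : IsSublinear ρ R)
    (hI : ∀ t z, HasFDerivAt (I t) (D z - L t) z) (y : ℝ → Z) :
    IsDifferentialSolution ι R I T z₀ y ↔ IsStrongSolution T z₀ L D (fun z => R (ι z)) y := by
  simp only [IsDifferentialSolution, IsStrongSolution, inclusion_iff hι hR, (hI _ _).fderiv,
    neg_sub]

/-- The error of the back-transformed iterates, in terms of the error at the grid points. -/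
theorem norm_retransformed_sub_le (hτ : 0 < τ) (hT : 0 < T)
    (h : IsIncremental T z₀ L D (fun z => R (ι z)) τ (finalIndex T t) t (fun k => z (k + 1)))
    (hz : ∀ k, ‖z (k + 1) - z k‖ ≤ τ) {y : ℝ → Z} {K : ℝ}
    (hy : ∀ a b, 0 ≤ a → a ≤ b → b ≤ T → ‖y b - y a‖ ≤ b - a)
    (herr : ∀ s ∈ Icc 0 T, ‖interp t (finalIndex T t) (fun k => z (k + 1)) s - y s‖ ≤ K * τ)
    {s : ℝ} (hs : s ∈ Icc 0 T) : ‖retransformed T τ z t s - y s‖ ≤ (K + 2) * τ := by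
  set N := finalIndex T t with hN
  have hbij := bijOn_affineInterpolant hτ h.t_lt
  rw [h.t_zero, h.t_last] at hbij
  have hmem := Function.invFunOn_mem (hbij.surjOn hs)
  have heq := Function.invFunOn_eq (hbij.surjOn hs)
  unfold retransformed artificialInterval
  set a := Function.invFunOn (affineInterpolant τ t) (Icc 0 (N * τ)) s
  obtain ⟨k, θ, hk, hkN, h0, h1, ha⟩ := exists_cell_coordinates hτ hmem.1 hmem.2
  rw [ha, affineInterpolant_eq hτ z h0 h1]
  rw [ha, affineInterpolant_eq hτ t h0 h1, smul_eq_mul] at heq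
  have hinc : 0 ≤ s - t k ∧ s - t k ≤ τ := by
    rcases hk.eq_or_lt with hk' | hk'
    · rw [hkN hk', zero_mul, add_zero] at heq
      rw [heq, sub_self]
      exact ⟨le_rfl, hτ.le⟩
    · have e1 := sub_pos.2 (h.t_lt k hk')
      have e2 := mul_nonneg h0 e1.le
      have e3 := mul_le_of_le_one_left e1.le h1.le
      have e4 := h.t_step k hk'
      constructor <;> linarith
  have hnode : interp t N (fun k => z (k + 1)) (t k) = z (k + 1) := by
    rcases hk.eq_or_lt with hk' | hk'
    · obtain ⟨n, hn⟩ : ∃ n, N = n + 1 := by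
        refine Nat.exists_eq_succ_of_ne_zero fun h0 => ?_
        have e1 := h.t_zero
        have e2 := h.t_last
        rw [h0] at e2
        linarith
      have := interp_right h.t_lt (fun k => z (k + 1)) (k := n) (by omega)
      rw [hk', hn] at *
      exact this
    · exact interp_left h.t_lt (fun k => z (k + 1)) hk'
  have e1 := herr (t k) (h.mem_Icc hk)
  rw [hnode] at e1
  have e2 := hy (t k) s (h.mem_Icc hk).1 (sub_nonneg.1 hinc.1) hs.2
  -- At time `t k` the shifted interpolant takes the value `z (k + 1)`. The shift and the motion of
  -- `y` over part of a cell each cost one `τ`, whence the added `2`.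
  have e3 : z k + θ • (z (k + 1) - z k) - y s =
      -((1 - θ) • (z (k + 1) - z k)) + (z (k + 1) - y (t k)) - (y s - y (t k)) := by module
  rw [e3]
  have e4 : ‖-((1 - θ) • (z (k + 1) - z k))‖ ≤ τ := by
    rw [norm_neg, norm_smul, Real.norm_of_nonneg (by linarith)]
    exact (mul_le_of_le_one_left (norm_nonneg _) (by linarith)).trans (hz k)
  have e5 := norm_sub_le (-((1 - θ) • (z (k + 1) - z k)) + (z (k + 1) - y (t k))) (y s - y (t k))
  have e6 := norm_add_le (-((1 - θ) • (z (k + 1) - z k))) (z (k + 1) - y (t k))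
  linarith [hinc.2]

end ErrorEstimate

end RIS

/-! ### Assembly of the theorem -/

theorem theorem3p9
    {Z V X : Type*}
    [NormedAddCommGroup Z] [InnerProductSpace ℝ Z] [CompleteSpace Z]
    [NormedAddCommGroup V] [InnerProductSpace ℝ V] [CompleteSpace V]
    [NormedAddCommGroup X] [NormedSpace ℝ X] [CompleteSpace X]
    (ι : Z →L[ℝ] V) (hι : RIS.IsCompactDenseEmbedding ι)
    (j : V →L[ℝ] X) (hj : Function.Injective j)
    (T : ℝ) (hT : 0 < T)
    (F : Z → ℝ) (hF : RIS.IsLowerOrder ι F)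
    (α κ δ M : ℝ) (hα : 0 < α) (hκ : 0 < κ) (hδ : 0 < δ) (hδκ : δ ≤ κ)
    (ℓ : ℝ → StrongDual ℝ V)
    (hℓLip : ∀ s ∈ Set.Icc 0 T, ∀ t ∈ Set.Icc 0 T, ‖ℓ s - ℓ t‖ ≤ (κ - δ) * |s - t|)
    (hℓBV : RIS.IsLoadBV T ℓ)
    (z₀ : Z) :
    -- the constant may depend on all of the above, but not on `A` beyond `α` and `‖A‖ = M`,
    -- not on `R`, and not on `τ`
    ∃ K : ℝ, 0 < K ∧
      ∀ A : Z →L[ℝ] StrongDual ℝ Z, RIS.IsCoerciveSymm α A → ‖A‖ = M →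
      ∀ R : V → ℝ, RIS.IsDissipation j R →
      (∀ t ∈ Set.Icc 0 T, RIS.IsC21loc (RIS.energy ι A F ℓ t)) →
      (∀ t ∈ Set.Icc 0 T, RIS.IsUniformlyConvex κ (RIS.energy ι A F ℓ t)) →
      -- the initial state is locally stable
      RIS.Inclusion ι R (RIS.energy ι A F ℓ 0) 0 z₀ →
      -- there is a differential solution `z`, unique on `[0,T]`
      ∃ z : ℝ → Z, RIS.IsDifferentialSolution ι R (RIS.energy ι A F ℓ) T z₀ z ∧
        (∀ y : ℝ → Z, RIS.IsDifferentialSolution ι R (RIS.energy ι A F ℓ) T z₀ y →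
          Set.EqOn y z (Set.Icc 0 T)) ∧
        -- the scheme is solvable for every step size
        (∀ τ : ℝ, 0 < τ → ∃ (zk : ℕ → Z) (tk : ℕ → ℝ),
          RIS.IsLocalMinScheme ι R (RIS.energy ι A F ℓ) T z₀ τ zk tk) ∧
        -- for all iterates, the final time is reached, the back-transformation exists,
        -- and the error estimate holds
        (∀ τ : ℝ, 0 < τ → ∀ (zk : ℕ → Z) (tk : ℕ → ℝ),
          RIS.IsLocalMinScheme ι R (RIS.energy ι A F ℓ) T z₀ τ zk tk →
            tk (RIS.finalIndex T tk) = T ∧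
            StrictMonoOn (RIS.affineInterpolant τ tk) (RIS.artificialInterval T τ tk) ∧
            Set.BijOn (RIS.affineInterpolant τ tk) (RIS.artificialInterval T τ tk)
              (Set.Icc 0 T) ∧
            ∀ t ∈ Set.Icc 0 T, ‖RIS.retransformed T τ zk tk t - z t‖ ≤ K * τ) ∧
        -- convergence of the discrete solutions as the step size tends to zero
        (∀ (zk : ℝ → ℕ → Z) (tk : ℝ → ℕ → ℝ),
          (∀ τ : ℝ, 0 < τ →
            RIS.IsLocalMinScheme ι R (RIS.energy ι A F ℓ) T z₀ τ (zk τ) (tk τ)) →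
          TendstoUniformlyOn (fun τ => RIS.retransformed T τ (zk τ) (tk τ)) z
            (𝓝[>] 0) (Set.Icc 0 T)) := by
  obtain ⟨m, W, hload⟩ := RIS.exists_isLoad hι.norm_le hT.le hℓLip hℓBV
  set L : ℝ → StrongDual ℝ Z := fun t => (ℓ t).comp ι with hLdef
  have hloadκ : RIS.IsLoad T κ L m W :=
    ⟨fun s hs t ht => (hload.lip s hs t ht).trans
      (mul_le_mul_of_nonneg_right (by linarith) (abs_nonneg _)), hload.mono, hload.taylor⟩
  have hW : 0 ≤ W T - W 0 :=
    sub_nonneg.2 (hload.mono (left_mem_Icc.2 hT.le) (right_mem_Icc.2 hT.le) hT.le)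
  -- Speed at most one keeps all solutions and interpolants in this ball.
  set r : ℝ := ‖z₀‖ + T with hr
  have hr0 : 0 ≤ r := by positivity
  -- The Lipschitz constant must be chosen before `A` and `R`. If the second derivative of `F` has
  -- none on the ball, no `A` satisfies the `C^{2,1}` hypothesis, and any `K` works.
  by_cases hCF : ∃ C : ℝ, 0 ≤ C ∧ ∀ x y : Z, ‖x‖ ≤ r → ‖y‖ ≤ r →
      ‖fderiv ℝ (fderiv ℝ F) x - fderiv ℝ (fderiv ℝ F) y‖ ≤ C * ‖x - y‖
  swap
  · refine ⟨1, one_pos, fun A hA _ R _ hC21 => ?_⟩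
    exact absurd (RIS.exists_lipschitz_hessian hA.symm hF.contDiff hr0
      (hC21 0 (left_mem_Icc.2 hT.le))) hCF
  obtain ⟨C, hC, hCF⟩ := hCF
  set c := 1 + 2 * C + κ + 2 * (W T - W 0) + 3 * C * T with hc
  have hc0 : 0 < c := by positivity
  set K₀ := 4 * (Real.exp (6 * C / κ * T) / κ) + 4 * T + 3 with hK₀
  have hK₀0 : 0 < K₀ := by positivity
  refine ⟨K₀ * c + 2, by positivity, fun A hA _ R hR hC21 hconv hstable => ?_⟩
  obtain ⟨ρ, hρ, hRs⟩ := hR.exists_isSublinear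
  have hRZ := hRs.comp_embedding hι.norm_le hρ.le
  have hD := RIS.isEnergyDeriv hA.symm hF.contDiff hr0 hC hCF
    (hconv 0 (left_mem_Icc.2 hT.le))
  have hI := fun t z => RIS.hasFDerivAt_energy (ι := ι) (ℓ := ℓ) hA.symm hF.contDiff t z
  have hstab : ∀ w, (L 0 - RIS.energyDeriv A F z₀) w ≤ R (ι w) := by
    have := ((RIS.inclusion_iff hι.injective hRs).1 hstable).1
    rwa [(hI 0 z₀).fderiv, neg_sub] at this
  have hex : ∀ τ : ℝ, 0 < τ → ∃ (zk : ℕ → Z) (tk : ℕ → ℝ),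
      RIS.IsLocalMinScheme ι R (RIS.energy ι A F ℓ) T z₀ τ zk tk := fun τ hτ =>
    RIS.exists_isLocalMinScheme hD hκ hI hRZ hτ.le
  have hinc : ∀ τ : ℝ, 0 < τ → ∀ (zk : ℕ → Z) (tk : ℕ → ℝ),
      RIS.IsLocalMinScheme ι R (RIS.energy ι A F ℓ) T z₀ τ zk tk →
      RIS.IsIncremental T z₀ L (RIS.energyDeriv A F) (fun z => R (ι z)) τ
        (RIS.finalIndex T tk) tk (fun k => zk (k + 1)) := fun τ hτ zk tk h =>
    h.isIncremental hD hκ hδ hδκ hι.norm_le hT.le hload.lip hI hRZ hstab hτ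
  have happrox := fun τ hτ zk tk h =>
    (hinc τ hτ zk tk h).isApproxSolution hD hC hκ.le hRZ hT le_rfl hloadκ
  -- Existence of the solution uses arbitrary iterates with steps `1/(n+1)`; their interpolants have
  -- levels tending to zero.
  choose zs ts hs using fun n : ℕ => hex (1 / ((n : ℝ) + 1)) (by positivity)
  have hlim : Tendsto (fun n : ℕ => c * (1 / ((n : ℝ) + 1))) atTop (𝓝 0) := by
    simpa using tendsto_one_div_add_atTop_nhds_zero_nat.const_mul c
  obtain ⟨z, hz⟩ := RIS.exists_isStrongSolution hD hC hκ hRZ hT hloadκ.lip hlim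
    fun n => happrox _ (by positivity) _ _ (hs n)
  have hsol := RIS.isDifferentialSolution_iff (T := T) (z₀ := z₀) hι.injective hRs hI
  obtain ⟨σ, p, q, P, B, hza⟩ := hz.isApproxSolution hD hκ hRZ hT hloadκ.lip le_rfl
  have herr : ∀ τ : ℝ, 0 < τ → ∀ (zk : ℕ → Z) (tk : ℕ → ℝ),
      RIS.IsLocalMinScheme ι R (RIS.energy ι A F ℓ) T z₀ τ zk tk →
      ∀ t ∈ Icc 0 T, ‖RIS.retransformed T τ zk tk t - z t‖ ≤ (K₀ * c + 2) * τ := by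
    intro τ hτ zk tk h t ht
    have hk := h.step hD hκ hδ hδκ hι.norm_le hT.le hload.lip hI hRZ hstab hτ
    refine RIS.norm_retransformed_sub_le hτ hT (hinc τ hτ zk tk h) (fun k => ?_)
      (fun a b ha hab hb => RIS.norm_sub_le_of_right_increments hza.cont hza.right_lip ha hab hb)
      (fun s hs => ?_) ht
    · obtain ⟨⟨-, h1, -, h3, -⟩, h4⟩ := hk k
      refine le_of_mul_le_mul_left (h4.trans ?_) hκ
      exact mul_le_mul (by linarith) h3 (sub_nonneg.2 h1) hκ.le
    · obtain ⟨_, _, _, _, _, hka⟩ := happrox τ hτ zk tk h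
      have := hka.norm_diff_le hD hC hκ hT hza s hs
      rw [add_zero, ← mul_assoc] at this
      exact this
  refine ⟨z, (hsol z).2 hz, fun y hy t ht => ?_, hex, fun τ hτ zk tk h => ?_,
    fun zk tk h => ?_⟩
  · obtain ⟨_, _, _, _, _, hya⟩ :=
      ((hsol y).1 hy).isApproxSolution hD hκ hRZ hT hloadκ.lip le_rfl
    have := hya.norm_diff_le hD hC hκ hT hza t ht
    rw [add_zero, mul_zero] at this
    exact sub_eq_zero.1 (norm_le_zero_iff.1 this)
  · have hi := hinc τ hτ zk tk h
    have hb := RIS.bijOn_affineInterpolant hτ hi.t_lt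
    rw [hi.t_zero, hi.t_last] at hb
    exact ⟨hi.t_last, RIS.strictMonoOn_affineInterpolant hτ hi.t_lt, hb, herr τ hτ zk tk h⟩
  · rw [Metric.tendstoUniformlyOn_iff]
    intro ε hε
    have hpos : 0 < K₀ * c + 2 := by positivity
    filter_upwards [Ioo_mem_nhdsGT (show 0 < ε / (K₀ * c + 2) by positivity)] with τ hτ t ht
    rw [dist_comm, dist_eq_norm]
    refine (herr τ hτ.1 _ _ (h τ hτ.1) t ht).trans_lt ?_
    have := (lt_div_iff₀ hpos).1 hτ.2
    linarith
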